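/- **Conventions.** A *regular category* is a category with finite limits in which every kernel pair has a coequalizer and regular epimorphisms are stable under pullback; a *regular functor* preserves finite limits and regular epimorphisms. $\mathrm{RgCat}$ is the category of small regular categories and regular functors. For a regular category $\mathcal C$, $\mathbb{R}\mathrm{el}_{\mathcal C}$ is the symmetric monoidal locally posetal 2-category (po-category) with the objects of $\mathcal C$, the subobjects of $X\times Y$ (ordered as subobjects) as morphisms $X\to Y$, composition by pullback followed by image, and monoidal structure induced by finite products. A regular functor $\mathcal F$ induces a po-functor $\mathbb{R}\mathrm{el}_{\mathcal F}$ by applying $\mathcal F$ and taking images. For a set $T$, $\mathrm{FRg}(T)$ is the category of *contexts* $\Gamma=(n,S,\tau)$, where $n\in\mathbb N$, $S\subseteq T$ is finite and $\tau:\{1,\dots,n\}\to S$; a morphism $(n,S,\tau)\to(n',S',\tau')$ is a function $f:\{1,\dots,n'\}\to\{1,\dots,n\}$ with $\tau\circ f=\tau'$, and it exists only if $S'\subseteq S$. It is a regular category, with terminal object $0=(0,\emptyset,!)$ and products $(n,S,\tau)\oplus(n',S',\tau')=(n+n',S\cup S',[\tau,\tau'])$. A function $F:T\to T'$ induces $\mathrm{FRg}(F):\mathrm{FRg}(T)\to\mathrm{FRg}(T')$,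 $(n,S,\tau)\mapsto(n,F(S),F\circ\tau)$. A *regular calculus* is a pair $(T,P)$ of a set $T$ and a lax symmetric monoidal po-functor $P:\mathbb{R}\mathrm{el}_{\mathrm{FRg}(T)}\to\mathbb{P}\mathrm{oset}$ (with strictly natural laxators, $\mathbb{P}\mathrm{oset}$ being monoidal under cartesian product) whose laxators $1\to P(0)$ and $P(\Gamma)\times P(\Delta)\to P(\Gamma\oplus\Delta)$ are right adjoints. A morphism $(T,P)\to(T',P')$ is a pair $(F,F^\sharp)$ of a function $F:T\to T'$ and a strict monoidal natural transformation $F^\sharp:P\to P'\circ\mathbb{R}\mathrm{el}_{\mathrm{FRg}(F)}$. These form the category $\mathrm{RgCalc}$. For a regular category $\mathcal R$, write $\mathrm{Supp}(r)$ for the image of $r\to 1$, and let $\ulcorner-\urcorner:\mathrm{FRg}(\mathrm{Ob}\,\mathcal R)\to\mathcal R$ be the functor $\ulcorner(n,S,\tau)\urcorner=\prod_{i}\tau(i)\times\prod_{s\in S}\mathrm{Supp}(s)$, acting on morphisms by reindexing the factors. Let $\mathrm{Sub}_{\mathcal R}^{\ulcorner-\urcorner}$ send $\Gamma$ to the poset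 of subobjects of $\ulcorner\Gamma\urcorner$, and send a relation $x$ from $\Gamma$ to $\Delta$ to the map $g_!f^*$, where $\ulcorner\Gamma\urcorner\xleftarrow{f}A\xrightarrow{g}\ulcorner\Delta\urcorner$ is the relation in $\mathcal R$ that $x$ induces, $f^*$ is pullback and $g_!$ is image; its laxators are the top subobject of $\ulcorner 0\urcorner$ and $(\varphi,\psi)\mapsto\varphi\times\psi$. **Proposition.** For every regular category $\mathcal R$ the pair $\mathrm{prd}(\mathcal R)=(\mathrm{Ob}\,\mathcal R,\mathrm{Sub}_{\mathcal R}^{\ulcorner-\urcorner})$ is a regular calculus. For every regular functor $\mathcal F:\mathcal R\to\mathcal R'$ the pair $\mathrm{prd}(\mathcal F)=(\mathrm{Ob}\,\mathcal F,\mathrm{Sub}_{\mathcal F}^{\ulcorner-\urcorner})$, whose second component sends a subobject $\varphi\subseteq\ulcorner\Gamma\urcorner$ to $\mathcal F(\varphi)\subseteq\mathcal F\ulcorner\Gamma\urcorner\cong\ulcorner\mathrm{FRg}(\mathrm{Ob}\,\mathcal F)(\Gamma)\urcorner$, is a morphism of regular calculi. These assignments form a functor $\mathrm{prd}:\mathrm{RgCat}\to\mathrm{RgCalc}$,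 and this functor is faithful and full. -/

import Mathlib

open CategoryTheory CategoryTheory.Limits MonoidalCategory CartesianMonoidalCategory

attribute [-instance] CategoryTheory.catToReflQuiver

set_option linter.unusedSectionVars false
set_option linter.checkUnivs false

universe w v u

namespace GraphicalRegularLogic

/-- A context over a set `T` of types: an arity `n`, a finite support `S ⊆ T`, and a typing
`{1, …, n} → S`. These are the objects of the free regular category `FRg(T)`. -/
structure Ctx (T : Type u) where
  n : ℕ
  S : Set T
  finite_S : S.Finite
  τ : Fin n → T
  τ_mem : ∀ i, τ i ∈ S

namespace Ctx

variable {T : Type u}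

/-- A morphism of contexts `(n, S, τ) ⟶ (n', S', τ')` is a function `n' → n` over `T`, subject to
`S' ⊆ S`: the category of contexts is the opposite of the comma category `FinSet ↓ 𝒫_f(T)`. -/
@[ext]
structure Hom (Γ Δ : Ctx T) where
  fn : Fin Δ.n → Fin Γ.n
  supp_le : Δ.S ⊆ Γ.S
  comm : ∀ i, Γ.τ (fn i) = Δ.τ i

instance : Category (Ctx T) where
  Hom := Hom
  id Γ := ⟨id, subset_rfl, fun _ => rfl⟩
  comp f g := ⟨f.fn ∘ g.fn, g.supp_le.trans f.supp_le,
    fun i => (f.comm (g.fn i)).trans (g.comm i)⟩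

theorem hom_ext {Γ Δ : Ctx T} {f g : Γ ⟶ Δ} (h : ∀ i, f.fn i = g.fn i) : f = g :=
  Hom.ext (funext h)

@[simp] theorem id_fn (Γ : Ctx T) (i : Fin Γ.n) : (𝟙 Γ : Γ ⟶ Γ).fn i = i := rfl

@[simp] theorem comp_fn {Γ Δ Θ : Ctx T} (f : Γ ⟶ Δ) (g : Δ ⟶ Θ) (i : Fin Θ.n) :
    (f ≫ g).fn i = f.fn (g.fn i) := rfl

/-- The empty context `(0, ∅, !)`, the terminal object. -/
def empty (T : Type u) : Ctx T where
  n := 0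
  S := ∅
  finite_S := Set.finite_empty
  τ := Fin.elim0
  τ_mem i := i.elim0

/-- The product `Γ ⊕ Δ = (n + n', S ∪ S', [τ, τ'])` of contexts. -/
def sum (Γ Δ : Ctx T) : Ctx T where
  n := Γ.n + Δ.n
  S := Γ.S ∪ Δ.S
  finite_S := Γ.finite_S.union Δ.finite_S
  τ := Fin.append Γ.τ Δ.τ
  τ_mem i := by
    refine Fin.addCases (fun i => ?_) (fun i => ?_) i
    · rw [Fin.append_left]; exact Or.inl (Γ.τ_mem i)
    · rw [Fin.append_right]; exact Or.inr (Δ.τ_mem i)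

/-- The first projection of `Γ ⊕ Δ`. -/
def sumFst (Γ Δ : Ctx T) : sum Γ Δ ⟶ Γ :=
  ⟨Fin.castAdd Δ.n, Set.subset_union_left, fun i => Fin.append_left _ _ i⟩

/-- The second projection of `Γ ⊕ Δ`. -/
def sumSnd (Γ Δ : Ctx T) : sum Γ Δ ⟶ Δ :=
  ⟨Fin.natAdd Γ.n, Set.subset_union_right, fun i => Fin.append_right _ _ i⟩

/-- The pairing into `Γ ⊕ Δ`. -/
def sumLift {Γ Δ Θ : Ctx T} (f : Θ ⟶ Γ) (g : Θ ⟶ Δ) : Θ ⟶ sum Γ Δ :=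
  ⟨Fin.append f.fn g.fn, Set.union_subset f.supp_le g.supp_le, fun i => by
    refine Fin.addCases (fun i => ?_) (fun i => ?_) i
    · rw [Fin.append_left]; exact (f.comm i).trans (Fin.append_left _ _ i).symm
    · rw [Fin.append_right]; exact (g.comm i).trans (Fin.append_right _ _ i).symm⟩

theorem sumLift_fst {Γ Δ Θ : Ctx T} (f : Θ ⟶ Γ) (g : Θ ⟶ Δ) :
    sumLift f g ≫ sumFst Γ Δ = f :=
  hom_ext fun i => Fin.append_left _ _ i

theorem sumLift_snd {Γ Δ Θ : Ctx T} (f : Θ ⟶ Γ) (g : Θ ⟶ Δ) :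
    sumLift f g ≫ sumSnd Γ Δ = g :=
  hom_ext fun i => Fin.append_right _ _ i

theorem sum_hom_ext {Γ Δ Θ : Ctx T} {f g : Θ ⟶ sum Γ Δ} (h₁ : f ≫ sumFst Γ Δ = g ≫ sumFst Γ Δ)
    (h₂ : f ≫ sumSnd Γ Δ = g ≫ sumSnd Γ Δ) : f = g := by
  refine hom_ext fun i => ?_
  refine Fin.addCases (fun i => ?_) (fun i => ?_) i
  · exact congrFun (congrArg Hom.fn h₁) i
  · exact congrFun (congrArg Hom.fn h₂) i

/-- The cartesian monoidal structure of the category of contexts, with unit `(0, ∅, !)` and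
tensor product `⊕`. -/
instance : CartesianMonoidalCategory (Ctx T) :=
  .ofChosenFiniteProducts
    ⟨asEmptyCone (empty T), IsTerminal.ofUniqueHom
      (fun _ => ⟨Fin.elim0, Set.empty_subset _, fun i => i.elim0⟩)
      (fun _ _ => hom_ext fun i => i.elim0)⟩
    (fun Γ Δ => ⟨BinaryFan.mk (sumFst Γ Δ) (sumSnd Γ Δ),
      BinaryFan.isLimitMk (fun s => sumLift s.fst s.snd)
        (fun _ => sumLift_fst _ _) (fun _ => sumLift_snd _ _)
        (fun _ _ h₁ h₂ => sum_hom_ext (h₁.trans (sumLift_fst _ _).symm)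
          (h₂.trans (sumLift_snd _ _).symm))⟩)

theorem tensor_eq (Γ Δ : Ctx T) : Γ ⊗ Δ = sum Γ Δ := rfl

theorem unit_eq : 𝟙_ (Ctx T) = empty T := rfl

/-! ### The category of contexts is regular -/

theorem hasEqualizers : HasEqualizers (Ctx T) := by
  suffices h : ∀ {Γ Δ : Ctx T} {f g : Γ ⟶ Δ}, HasLimit (parallelPair f g) from
    hasEqualizers_of_hasLimit_parallelPair _
  intro Γ Δ f g
  let r : Fin Γ.n → Fin Γ.n → Prop := fun a b => ∃ i, a = f.fn i ∧ b = g.fn i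
  obtain ⟨m, ⟨e⟩⟩ := Finite.exists_equiv_fin (Quot r)
  let t : Quot r → T := Quot.lift Γ.τ (by
    rintro _ _ ⟨i, rfl, rfl⟩
    rw [f.comm, g.comm])
  let E : Ctx T :=
    { n := m
      S := Γ.S
      finite_S := Γ.finite_S
      τ := fun i => t (e.symm i)
      τ_mem := fun i => by
        obtain ⟨a, ha⟩ := Quot.exists_rep (e.symm i)
        rw [← ha]; exact Γ.τ_mem a }
  let ι : E ⟶ Γ := ⟨fun a => e (Quot.mk r a), subset_rfl, fun a => by simp [E, t]⟩
  have w : ι ≫ f = ι ≫ g := hom_ext fun i => by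
    simp only [comp_fn, ι]
    exact congrArg e (Quot.sound ⟨i, rfl, rfl⟩)
  have hlim : IsLimit (Fork.ofι ι w) := by
    refine Fork.IsLimit.mk _
      (fun s => ⟨fun i => Quot.lift s.ι.fn (by
          rintro _ _ ⟨j, rfl, rfl⟩
          exact congrFun (congrArg Hom.fn s.condition) j) (e.symm i), s.ι.supp_le, fun i => ?_⟩)
      (fun s => hom_ext fun i => ?_) (fun s m hm => hom_ext fun i => ?_)
    · exact Quot.ind (β := fun q => s.pt.τ (Quot.lift s.ι.fn _ q) = t q) s.ι.comm (e.symm i)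
    · simp [ι]
    · obtain ⟨a, ha⟩ := Quot.exists_rep (e.symm i)
      obtain rfl : i = e (Quot.mk r a) := by rw [ha]; simp
      have := congrFun (congrArg Hom.fn hm) a
      simpa [ι] using this
  exact ⟨⟨_, hlim⟩⟩

instance : HasFiniteLimits (Ctx T) :=
  have : HasEqualizers (Ctx T) := hasEqualizers
  have : HasFiniteProducts (Ctx T) := inferInstance
  hasFiniteLimits_of_hasEqualizers_and_finite_products

theorem hasCoequalizer {Γ Δ : Ctx T} (f g : Γ ⟶ Δ) : HasCoequalizer f g := by
  obtain ⟨m, ⟨e⟩⟩ := Finite.exists_equiv_fin {i : Fin Δ.n // f.fn i = g.fn i}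
  let E : Ctx T :=
    { n := m
      S := Δ.S
      finite_S := Δ.finite_S
      τ := fun i => Δ.τ (e.symm i)
      τ_mem := fun i => Δ.τ_mem _ }
  let p : Δ ⟶ E := ⟨fun i => (e.symm i).1, subset_rfl, fun i => rfl⟩
  have w : f ≫ p = g ≫ p := hom_ext fun i => (e.symm i).2
  have hcol : IsColimit (Cofork.ofπ p w) := by
    refine Cofork.IsColimit.mk _
      (fun s => ⟨fun i => e ⟨s.π.fn i, congrFun (congrArg Hom.fn s.condition) i⟩,
        s.π.supp_le, fun i => ?_⟩)
      (fun s => hom_ext fun i => ?_) (fun s m hm => hom_ext fun i => ?_)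
    · change Δ.τ (e.symm (e _)).1 = _
      rw [Equiv.symm_apply_apply]; exact s.π.comm i
    · simp [p]
    · have := congrFun (congrArg Hom.fn hm) i
      apply e.symm.injective
      apply Subtype.ext
      simpa [p] using this
  exact ⟨⟨_, hcol⟩⟩

/-- A morphism of contexts is a regular epimorphism iff the underlying function is injective and
the supports agree. -/
theorem isRegularEpi_iff {Γ Δ : Ctx T} (f : Γ ⟶ Δ) :
    IsRegularEpi f ↔ Function.Injective f.fn ∧ Δ.S = Γ.S := by
  constructor
  · rintro ⟨⟨hf⟩⟩
    constructor
    · intro i j hij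
      have hτ : Δ.τ i = Δ.τ j := by rw [← f.comm, ← f.comm, hij]
      let E : Ctx T := ⟨1, Δ.S, Δ.finite_S, fun _ => Δ.τ i, fun _ => Δ.τ_mem i⟩
      let a : Δ ⟶ E := ⟨fun _ => i, subset_rfl, fun _ => rfl⟩
      let b : Δ ⟶ E := ⟨fun _ => j, subset_rfl, fun _ => hτ.symm⟩
      have hab : f ≫ a = f ≫ b := hom_ext fun _ => hij
      have : a = b := Cofork.IsColimit.hom_ext hf.isColimit hab
      exact congrFun (congrArg Hom.fn this) 0
    · refine subset_antisymm f.supp_le ?_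
      let E : Ctx T := ⟨Δ.n, Γ.S, Γ.finite_S, Δ.τ, fun i => f.supp_le (Δ.τ_mem i)⟩
      let q : Γ ⟶ E := ⟨f.fn, subset_rfl, f.comm⟩
      have hq : hf.left ≫ q = hf.right ≫ q :=
        hom_ext fun i => congrFun (congrArg Hom.fn hf.w) i
      exact (Cofork.IsColimit.desc hf.isColimit q hq).supp_le
  · rintro ⟨hinj, hS⟩
    classical
    let W : Ctx T := sum Γ Γ
    let l : W ⟶ Γ := sumFst Γ Γ
    let r : W ⟶ Γ := ⟨fun i => if i ∈ Set.range f.fn then Fin.castAdd _ i else Fin.natAdd _ i,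
      (Set.union_self Γ.S).symm.subset, fun i => by
        dsimp only [W, sum]
        split_ifs
        · exact Fin.append_left _ _ i
        · exact Fin.append_right _ _ i⟩
    have hw : l ≫ f = r ≫ f := hom_ext fun i =>
      (if_pos (Set.mem_range_self i)).symm
    have key : ∀ {Θ : Ctx T} (s : Γ ⟶ Θ), l ≫ s = r ≫ s → ∀ i, s.fn i ∈ Set.range f.fn := by
      intro Θ s hs i
      by_contra hi
      have h := congrFun (congrArg Hom.fn hs) i
      replace h : Fin.castAdd Γ.n (s.fn i) = Fin.natAdd Γ.n (s.fn i) := h.trans (if_neg hi)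
      have h' := congrArg Fin.val h
      simp only [Fin.val_castAdd, Fin.val_natAdd] at h'
      have := (s.fn i).isLt
      omega
    refine ⟨⟨⟨W, l, r, hw, Cofork.IsColimit.mk _
      (fun s => ⟨fun i => (key s.π s.condition i).choose, hS ▸ s.π.supp_le, fun i => ?_⟩)
      (fun s => hom_ext fun i => (key s.π s.condition i).choose_spec)
      (fun s m hm => hom_ext fun i => hinj ?_)⟩⟩⟩
    · exact (f.comm _).symm.trans
        ((congrArg Γ.τ (key s.π s.condition i).choose_spec).trans (s.π.comm i))
    · exact (congrFun (congrArg Hom.fn hm) i).trans (key s.π s.condition i).choose_spec.symm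

instance : Regular (Ctx T) where
  hasCoequalizer_of_isKernelPair _ := hasCoequalizer _ _
  regularEpiIsStableUnderBaseChange := by
    refine ⟨fun {X Y P B f g f' g'} sq hg => ?_⟩
    obtain ⟨hinj, hS⟩ := (isRegularEpi_iff g).1 hg
    classical
    let Q : Ctx T :=
      { n := X.n + Y.n
        S := X.S
        finite_S := X.finite_S
        τ := Fin.append X.τ Y.τ
        τ_mem := fun i => by
          refine Fin.addCases (fun i => ?_) (fun i => ?_) i
          · rw [Fin.append_left]; exact X.τ_mem i
          · rw [Fin.append_right]; exact f.supp_le (hS ▸ Y.τ_mem i) }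
    let a : Q ⟶ X := ⟨Fin.castAdd Y.n, subset_rfl, fun i => Fin.append_left _ _ i⟩
    let b : Q ⟶ Y := ⟨fun y => if h : y ∈ Set.range g.fn then Fin.castAdd Y.n (f.fn h.choose)
        else Fin.natAdd X.n y, hS ▸ f.supp_le, fun y => by
      dsimp only [Q]
      split_ifs with h
      · rw [Fin.append_left, f.comm, ← g.comm, h.choose_spec]
      · exact Fin.append_right _ _ y⟩
    have hab : b ≫ g = a ≫ f := hom_ext fun i => by
      have h : g.fn i ∈ Set.range g.fn := Set.mem_range_self i
      exact (dif_pos h).trans (congrArg (fun j => Fin.castAdd Y.n (f.fn j)) (hinj h.choose_spec))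
    have hl : sq.lift b a hab ≫ g' = a := sq.lift_snd b a hab
    refine (isRegularEpi_iff g').2 ⟨fun i j hij => ?_,
      subset_antisymm g'.supp_le (sq.lift b a hab).supp_le⟩
    have hi := congrFun (congrArg Hom.fn hl) i
    have hj := congrFun (congrArg Hom.fn hl) j
    refine Fin.castAdd_injective X.n Y.n (hi.symm.trans (Eq.trans ?_ hj))
    exact congrArg (sq.lift b a hab).fn hij

variable {T' T'' : Type u}

theorem ext' {Γ Δ : Ctx T} (hn : Γ.n = Δ.n) (hS : Γ.S = Δ.S)
    (hτ : ∀ i, Γ.τ i = Δ.τ (Fin.cast hn i)) : Γ = Δ := by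
  obtain ⟨n, S, _, τ, _⟩ := Γ
  obtain ⟨n', S', _, τ', _⟩ := Δ
  obtain rfl : n = n' := hn
  obtain rfl : S = S' := hS
  obtain rfl : τ = τ' := funext hτ
  rfl

theorem eqToHom_fn {Γ Δ : Ctx T} (h : Γ = Δ) (i : Fin Δ.n) :
    ((eqToHom h).fn i : ℕ) = i := by
  subst h; rfl

/-- The functor `FRg(F) : FRg(T) ⥤ FRg(T')` induced by a function `F : T → T'`; it sends
`(n, S, τ)` to `(n, F(S), F ∘ τ)`. -/
def map (F : T → T') : Ctx T ⥤ Ctx T' where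
  obj Γ := ⟨Γ.n, F '' Γ.S, Γ.finite_S.image F, F ∘ Γ.τ, fun i => ⟨_, Γ.τ_mem i, rfl⟩⟩
  map f := ⟨f.fn, Set.image_mono f.supp_le, fun i => congrArg F (f.comm i)⟩

theorem map_id : map (id : T → T) = 𝟭 (Ctx T) :=
  CategoryTheory.Functor.ext (fun Γ => ext' rfl (Set.image_id _) fun _ => rfl) fun Γ Δ f =>
    hom_ext fun i => by
      refine Fin.ext (Eq.trans ?_ (eqToHom_fn _ _).symm)
      exact congrArg (fun j => (f.fn j : ℕ)) (Fin.ext (eqToHom_fn _ i).symm)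

theorem map_comp (F : T → T') (G : T' → T'') : map (G ∘ F) = map F ⋙ map G :=
  CategoryTheory.Functor.ext (fun Γ => ext' rfl (Set.image_comp _ _ _) fun _ => rfl) fun Γ Δ f =>
    hom_ext fun i => by
      refine Fin.ext (Eq.trans ?_ (eqToHom_fn _ _).symm)
      exact congrArg (fun j => (f.fn j : ℕ)) (Fin.ext (eqToHom_fn _ i).symm)

theorem isRegularEpi_map (F : T → T') {Γ Δ : Ctx T} (f : Γ ⟶ Δ) (hf : IsRegularEpi f) :
    IsRegularEpi ((map F).map f) := by
  obtain ⟨h₁, h₂⟩ := (isRegularEpi_iff f).1 hf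
  exact (isRegularEpi_iff _).2 ⟨h₁, congrArg (F '' ·) h₂⟩

end Ctx

/-! ### Relations in a regular category -/

section Relations

variable {C : Type u} [Category.{v} C] [CartesianMonoidalCategory C] [Regular C]

/-- A relation `X ⇸ Y` in a regular category is a subobject of `X × Y`; relations are ordered as
subobjects. These are the hom-posets of the po-category of relations. -/
abbrev RelHom (X Y : C) : Type (max u v) := Subobject (X ⊗ Y)

namespace RelHom

variable {X Y Z X' Y' A B : C}

/-- The left leg of (the span underlying) a relation. -/
noncomputable def src (x : RelHom X Y) : (x : C) ⟶ X := x.arrow ≫ fst X Y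

/-- The right leg of (the span underlying) a relation. -/
noncomputable def tgt (x : RelHom X Y) : (x : C) ⟶ Y := x.arrow ≫ snd X Y

/-- The relation presented by a span, i.e. the image of `⟨f, g⟩ : A ⟶ X × Y`. -/
noncomputable def ofSpan (f : A ⟶ X) (g : A ⟶ Y) : RelHom X Y := imageSubobject (lift f g)

/-- The graph `⟨id, f⟩ ⊆ X × Y` of a morphism. -/
noncomputable def graph (f : X ⟶ Y) : RelHom X Y := ofSpan (𝟙 X) f

/-- The identity relation, the diagonal of `X × X`. -/
noncomputable def id (X : C) : RelHom X X := graph (𝟙 X)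

/-- The composite of relations: pull back over `Y` and take the image in `X × Z`. -/
noncomputable def comp (x : RelHom X Y) (y : RelHom Y Z) : RelHom X Z :=
  ofSpan (pullback.fst x.tgt y.src ≫ x.src) (pullback.snd x.tgt y.src ≫ y.tgt)

/-- The monoidal product of relations, inherited from the product of the category. -/
noncomputable def tensor (x : RelHom X Y) (x' : RelHom X' Y') : RelHom (X ⊗ X') (Y ⊗ Y') :=
  ofSpan (x.src ⊗ₘ x'.src) (x.tgt ⊗ₘ x'.tgt)

/-- The action of a functor on relations: take the image of
`F(x) ⟶ F(X × Y) ⟶ F(X) × F(Y)`. -/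
noncomputable def map {D : Type*} [Category* D] [CartesianMonoidalCategory D] [Regular D]
    (F : C ⥤ D) (x : RelHom X Y) : RelHom (F.obj X) (F.obj Y) :=
  ofSpan (F.map x.src) (F.map x.tgt)

/-- The action of a relation `X ← x → Y` on subobjects: pull back to `x` along the left leg, then
take the image along the right leg. -/
noncomputable def act (x : RelHom X Y) : Subobject X →o Subobject Y where
  toFun φ := (Subobject.exists x.tgt).obj ((Subobject.pullback x.src).obj φ)
  monotone' _ _ h :=
    (Subobject.exists x.tgt).monotone ((Subobject.pullback x.src).monotone h)

theorem ofSpan_precomp (e : B ⟶ A) [IsRegularEpi e] (f : A ⟶ X) (g : A ⟶ Y) :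
    ofSpan (e ≫ f) (e ≫ g) = ofSpan f g := by
  have h : lift (e ≫ f) (e ≫ g) = e ≫ lift f g := (comp_lift e f g).symm
  unfold ofSpan
  simp only [h]
  refine le_antisymm (imageSubobject_comp_le _ _) ?_
  have sq : CommSq (factorThruImageSubobject (e ≫ lift f g)) e
      (imageSubobject (e ≫ lift f g)).arrow (lift f g) := ⟨by simp⟩
  exact imageSubobject_le _ sq.lift sq.fac_right

theorem ofSpan_src_tgt (x : RelHom X Y) : ofSpan x.src x.tgt = x := by
  have h : lift x.src x.tgt = x.arrow := by
    unfold src tgt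
    rw [← comp_lift, lift_fst_snd, Category.comp_id]
  unfold ofSpan
  simp only [h, imageSubobject_mono, Subobject.mk_arrow]

/-- The regular epimorphism onto the image of a span. -/
theorem exists_cover (f : A ⟶ X) (g : A ⟶ Y) :
    ∃ e : A ⟶ ((ofSpan f g : RelHom X Y) : C), IsRegularEpi e ∧
      e ≫ (ofSpan f g).src = f ∧ e ≫ (ofSpan f g).tgt = g := by
  have h₁ : StrongEpi (factorThruImageSubobject (lift f g)) := by
    unfold factorThruImageSubobject; exact strongEpi_comp _ _
  have h₂ : IsRegularEpi (factorThruImageSubobject (lift f g)) := inferInstance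
  refine ⟨factorThruImageSubobject (lift f g), h₂, ?_, ?_⟩
  · exact (imageSubobject_arrow_comp_assoc _ _).trans (lift_fst _ _)
  · exact (imageSubobject_arrow_comp_assoc _ _).trans (lift_snd _ _)

section Functor

variable {D : Type*} [Category* D] [CartesianMonoidalCategory D] [Regular D]

theorem map_ofSpan (F : C ⥤ D) (hF : ∀ {X Y : C} (f : X ⟶ Y), IsRegularEpi f →
    IsRegularEpi (F.map f)) (f : A ⟶ X) (g : A ⟶ Y) :
    map F (ofSpan f g) = ofSpan (F.map f) (F.map g) := by
  obtain ⟨e, he, h₁, h₂⟩ := exists_cover f g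
  have := hF e he
  unfold map
  rw [← ofSpan_precomp (F.map e), ← F.map_comp, ← F.map_comp, h₁, h₂]

theorem map_graph (F : C ⥤ D) (hF : ∀ {X Y : C} (f : X ⟶ Y), IsRegularEpi f →
    IsRegularEpi (F.map f)) (f : X ⟶ Y) : map F (graph f) = graph (F.map f) := by
  unfold graph
  rw [map_ofSpan F hF, F.map_id]

theorem map_id (x : RelHom X Y) : map (𝟭 C) x = x := ofSpan_src_tgt x

theorem map_comp {E : Type*} [Category* E] [CartesianMonoidalCategory E] [Regular E]
    (F : C ⥤ D) (G : D ⥤ E) (hG : ∀ {X Y : D} (f : X ⟶ Y), IsRegularEpi f →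
      IsRegularEpi (G.map f)) (x : RelHom X Y) : map (F ⋙ G) x = map G (map F x) :=
  (map_ofSpan G hG _ _).symm

end Functor

theorem comp_graph (f : X ⟶ Y) (g : Y ⟶ Z) : comp (graph f) (graph g) = graph (f ≫ g) := by
  obtain ⟨a, ha, ha₁, ha₂⟩ : ∃ e : X ⟶ (graph f : C), IsRegularEpi e ∧
    e ≫ (graph f).src = 𝟙 X ∧ e ≫ (graph f).tgt = f := exists_cover (𝟙 X) f
  obtain ⟨b, hb, hb₁, hb₂⟩ : ∃ e : Y ⟶ (graph g : C), IsRegularEpi e ∧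
    e ≫ (graph g).src = 𝟙 Y ∧ e ≫ (graph g).tgt = g := exists_cover (𝟙 Y) g
  have hd : a ≫ (graph f).tgt = (f ≫ b) ≫ (graph g).src := by
    rw [ha₂, Category.assoc, hb₁, Category.comp_id]
  let d := pullback.lift a (f ≫ b) hd
  have h₁ : d ≫ pullback.fst _ _ ≫ (graph f).src = 𝟙 X := by
    rw [pullback.lift_fst_assoc]; exact ha₁
  have h₂ : d ≫ pullback.snd _ _ ≫ (graph g).tgt = f ≫ g := by
    rw [pullback.lift_snd_assoc, Category.assoc]; exact congrArg (f ≫ ·) hb₂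
  have : IsRegularEpi d := by
    have hbi : IsIso b := by
      have : Mono b := mono_of_mono_fac hb₁
      exact isIso_of_mono_of_strongEpi b
    have hs : (graph g).src = inv b := by
      rw [← cancel_epi b, IsIso.hom_inv_id]; exact hb₁
    have : IsIso (graph g).src := hs ▸ inferInstance
    have : StrongEpi a := inferInstance
    have hda : d = a ≫ inv (pullback.fst (graph f).tgt (graph g).src) := by
      rw [IsIso.eq_comp_inv]; exact pullback.lift_fst _ _ _
    have : StrongEpi d := hda ▸ strongEpi_comp _ _
    infer_instance
  unfold comp
  rw [← ofSpan_precomp d, h₁, h₂]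
  rfl

end RelHom

/-! ### Ajax po-functors to posets -/

variable (C) in
/-- The data of a lax monoidal po-functor from the po-category of relations in `C` to the
po-category of posets: a poset for every object, a monotone map for every relation, and the
laxators `1 → P(I)` and `P(X) × P(Y) → P(X ⊗ Y)`. -/
structure LaxData where
  obj : C → PartOrd.{w}
  map {X Y : C} : RelHom X Y → (obj X →o obj Y)
  unit : obj (𝟙_ C)
  lax (X Y : C) : obj X × obj Y →o obj (X ⊗ Y)

/-- The data `P` is an ajax po-functor: it preserves identities, composites and the order of
relations, the laxators are natural and satisfy the coherence laws of a lax symmetric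
monoidal functor (all strictly), and they are right adjoints in the po-category of posets. -/
structure LaxData.IsAjax (P : LaxData.{w} C) : Prop where
  map_id (X : C) : P.map (RelHom.id X) = OrderHom.id
  map_comp {X Y Z : C} (x : RelHom X Y) (y : RelHom Y Z) :
    P.map (x.comp y) = (P.map y).comp (P.map x)
  map_mono {X Y : C} {x x' : RelHom X Y} : x ≤ x' → P.map x ≤ P.map x'
  lax_natural {X Y X' Y' : C} (x : RelHom X Y) (x' : RelHom X' Y') (p : P.obj X) (p' : P.obj X') :
    P.map (x.tensor x') (P.lax X X' (p, p')) = P.lax Y Y' (P.map x p, P.map x' p')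
  lax_assoc {X Y Z : C} (p : P.obj X) (q : P.obj Y) (r : P.obj Z) :
    P.map (RelHom.graph (α_ X Y Z).hom) (P.lax (X ⊗ Y) Z (P.lax X Y (p, q), r)) =
      P.lax X (Y ⊗ Z) (p, P.lax Y Z (q, r))
  lax_left_unit {X : C} (p : P.obj X) :
    P.map (RelHom.graph (λ_ X).hom) (P.lax (𝟙_ C) X (P.unit, p)) = p
  lax_right_unit {X : C} (p : P.obj X) :
    P.map (RelHom.graph (ρ_ X).hom) (P.lax X (𝟙_ C) (p, P.unit)) = p
  lax_symm {X Y : C} (p : P.obj X) (q : P.obj Y) :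
    P.map (RelHom.graph (lift (snd X Y) (fst X Y))) (P.lax X Y (p, q)) = P.lax Y X (q, p)
  unit_adj : ∃ l : P.obj (𝟙_ C) →o PUnit.{1}, GaloisConnection l (fun _ => P.unit)
  lax_adj (X Y : C) : ∃ l : P.obj (X ⊗ Y) →o P.obj X × P.obj Y, GaloisConnection l (P.lax X Y)

namespace LaxData

/-- Transport along an equality of objects. -/
def eqHom (P : LaxData.{w} C) {X Y : C} (h : X = Y) : P.obj X →o P.obj Y :=
  h ▸ OrderHom.id

@[simp] theorem eqHom_rfl (P : LaxData.{w} C) {X : C} (h : X = X) (p : P.obj X) :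
    P.eqHom h p = p := rfl

theorem eqHom_eqHom (P : LaxData.{w} C) {X Y Z : C} (h : X = Y) (h' : Y = Z) (p : P.obj X) :
    P.eqHom h' (P.eqHom h p) = P.eqHom (h.trans h') p := by
  subst h; rfl

variable {D : Type*} [Category* D] [CartesianMonoidalCategory D] [Regular D]

/-- A family of monotone maps `P(X) → Q(H X)` is a (strict) monoidal natural transformation from
`P` to the composite of `Q` with the po-functor on relations induced by `H`: it is strictly natural
with respect to all relations and strictly commutes with the laxators, where the laxators of the
composite involve the comparison isomorphisms `H(I) ≅ I` and `H(X ⊗ Y) ≅ H(X) ⊗ H(Y)`. -/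
structure IsMonoidalNat (P : LaxData.{w} C) (H : C ⥤ D) (Q : LaxData.{w} D)
    (a : ∀ X, P.obj X →o Q.obj (H.obj X)) : Prop where
  natural {X Y : C} (x : RelHom X Y) (p : P.obj X) :
    a Y (P.map x p) = Q.map (RelHom.map H x) (a X p)
  unit : Q.map (RelHom.graph (CartesianMonoidalCategory.terminalComparison H)) (a (𝟙_ C) P.unit) = Q.unit
  lax {X Y : C} (p : P.obj X) (q : P.obj Y) :
    Q.map (RelHom.graph (CartesianMonoidalCategory.prodComparison H X Y)) (a (X ⊗ Y) (P.lax X Y (p, q))) =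
      Q.lax (H.obj X) (H.obj Y) (a X p, a Y q)

theorem IsMonoidalNat.of_eq {P : LaxData.{w} C} {Q : LaxData.{w} D} {H K : C ⥤ D} (h : H = K)
    {a : ∀ X, P.obj X →o Q.obj (H.obj X)} (ha : IsMonoidalNat P H Q a) :
    IsMonoidalNat P K Q (fun X => (Q.eqHom (congrArg (fun F => F.obj X) h)).comp (a X)) := by
  subst h; exact ha

theorem IsAjax.map_graph_comp {P : LaxData.{w} C} (hP : P.IsAjax) {X Y Z : C} (f : X ⟶ Y)
    (g : Y ⟶ Z) (p : P.obj X) :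
    P.map (RelHom.graph (f ≫ g)) p = P.map (RelHom.graph g) (P.map (RelHom.graph f) p) := by
  rw [← RelHom.comp_graph, hP.map_comp]; rfl

theorem IsMonoidalNat.id {P : LaxData.{w} C} (hP : P.IsAjax) :
    IsMonoidalNat P (𝟭 C) P (fun _ => OrderHom.id) where
  natural x p := by rw [RelHom.map_id]; rfl
  unit := by
    have : CartesianMonoidalCategory.terminalComparison (𝟭 C) = 𝟙 (𝟙_ C) := toUnit_unique _ _
    rw [this]
    exact congrFun (congrArg DFunLike.coe (hP.map_id _)) _
  lax {X Y} p q := by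
    have : CartesianMonoidalCategory.prodComparison (𝟭 C) X Y = 𝟙 (X ⊗ Y) := by
      apply CartesianMonoidalCategory.hom_ext <;> simp
    rw [this]
    exact congrFun (congrArg DFunLike.coe (hP.map_id _)) _

theorem IsMonoidalNat.comp {E : Type*} [Category* E] [CartesianMonoidalCategory E] [Regular E]
    {P : LaxData.{w} C} {Q : LaxData.{w} D} {R : LaxData.{w} E} (hR : R.IsAjax)
    {H : C ⥤ D} {K : D ⥤ E}
    (hK : ∀ {X Y : D} (f : X ⟶ Y), IsRegularEpi f → IsRegularEpi (K.map f))
    {a : ∀ X, P.obj X →o Q.obj (H.obj X)} {b : ∀ X, Q.obj X →o R.obj (K.obj X)}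
    (ha : IsMonoidalNat P H Q a) (hb : IsMonoidalNat Q K R b) :
    IsMonoidalNat P (H ⋙ K) R (fun X => (b (H.obj X)).comp (a X)) where
  natural x p := by
    rw [RelHom.map_comp H K hK]
    simp only [OrderHom.comp_coe, Function.comp_apply]
    rw [ha.natural, hb.natural]
  unit := by
    have : CartesianMonoidalCategory.terminalComparison (H ⋙ K) =
        K.map (CartesianMonoidalCategory.terminalComparison H) ≫
          CartesianMonoidalCategory.terminalComparison K :=
      toUnit_unique _ _
    rw [this, hR.map_graph_comp, ← RelHom.map_graph K hK, ← hb.unit, ← ha.unit]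
    exact congrArg _ (hb.natural _ _).symm
  lax {X Y} p q := by
    have : CartesianMonoidalCategory.prodComparison (H ⋙ K) X Y =
        K.map (CartesianMonoidalCategory.prodComparison H X Y) ≫ CartesianMonoidalCategory.prodComparison K (H.obj X) (H.obj Y) := by
      apply CartesianMonoidalCategory.hom_ext
      · refine (CartesianMonoidalCategory.prodComparison_fst (H ⋙ K) X Y).trans ?_
        change _ = _ ≫ fst (K.obj (H.obj X)) (K.obj (H.obj Y))
        rw [Category.assoc, CartesianMonoidalCategory.prodComparison_fst, ← K.map_comp,
          CartesianMonoidalCategory.prodComparison_fst]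
        rfl
      · refine (CartesianMonoidalCategory.prodComparison_snd (H ⋙ K) X Y).trans ?_
        change _ = _ ≫ snd (K.obj (H.obj X)) (K.obj (H.obj Y))
        rw [Category.assoc, CartesianMonoidalCategory.prodComparison_snd, ← K.map_comp,
          CartesianMonoidalCategory.prodComparison_snd]
        rfl
    rw [this, hR.map_graph_comp, ← RelHom.map_graph K hK]
    simp only [OrderHom.comp_coe, Function.comp_apply]
    refine Eq.trans (congrArg _ (hb.natural _ _).symm) ?_
    rw [ha.lax, hb.lax]; rfl

end LaxData

end Relations

/-! ### The category of regular calculi -/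

/-- The data of a regular calculus: a set `T` of types and the data of a lax monoidal po-functor
from the free regular po-category on `T`, the relations in `FRg(T)`, to posets. -/
structure CalcData where
  T : Type u
  P : LaxData.{w} (Ctx T)

/-- A regular calculus `(T, P)`: a set `T` and an ajax po-functor `P` from the relations
po-category of `FRg(T)` to posets. -/
structure RgCalc extends CalcData.{w, u} where
  isAjax : P.IsAjax

/-- The data of a morphism of regular calculi: a function `T → T'` and monotone maps
`P(Γ) → P'(FRg(F)(Γ))`. -/
@[ext]
structure CalcHomData (A B : CalcData.{w, u}) where
  toFun : A.T → B.T
  app (Γ : Ctx A.T) : A.P.obj Γ →o B.P.obj ((Ctx.map toFun).obj Γ)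

namespace RgCalc

/-- A morphism of regular calculi: a function `F : T → T'` together with a strict monoidal natural
transformation from `P` to the composite of `P'` with the relations po-functor of `FRg(F)`. -/
@[ext]
structure Hom (A B : RgCalc.{w, u}) extends CalcHomData A.toCalcData B.toCalcData where
  isMonoidalNat : LaxData.IsMonoidalNat A.P (Ctx.map toFun) B.P app

variable {A B C : RgCalc.{w, u}}

/-- The identity; `FRg(id)` is equal to the identity functor. -/
def Hom.id (A : RgCalc.{w, u}) : Hom A A where
  toFun := _root_.id
  app Γ := (A.P.eqHom (congrArg (fun F => F.obj Γ) Ctx.map_id.symm)).comp OrderHom.id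
  isMonoidalNat := (LaxData.IsMonoidalNat.id A.isAjax).of_eq Ctx.map_id.symm

/-- Composition of morphisms; `FRg(g ∘ f)` is equal to the composite of `FRg(f)` and `FRg(g)`. -/
def Hom.comp (f : Hom A B) (g : Hom B C) : Hom A C where
  toFun := g.toFun ∘ f.toFun
  app Γ := (C.P.eqHom
    (congrArg (fun F => F.obj Γ) (Ctx.map_comp f.toFun g.toFun).symm)).comp
      ((g.app _).comp (f.app Γ))
  isMonoidalNat := (LaxData.IsMonoidalNat.comp C.isAjax (Ctx.isRegularEpi_map _)
    f.isMonoidalNat g.isMonoidalNat).of_eq (Ctx.map_comp f.toFun g.toFun).symm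

theorem Hom.app_eqHom (f : Hom A B) {Γ Γ' : Ctx A.T} (h : Γ = Γ') (p : A.P.obj Γ) :
    f.app Γ' (A.P.eqHom h p) = B.P.eqHom (congrArg (Ctx.map f.toFun).obj h) (f.app Γ p) := by
  subst h; rfl

theorem Hom.ext' {f g : Hom A B} (h : f.toCalcHomData = g.toCalcHomData) : f = g := by
  cases f; cases g; cases h; rfl

instance : Category RgCalc.{w, u} where
  Hom := Hom
  id := Hom.id
  comp := Hom.comp
  id_comp f := Hom.ext' <| CalcHomData.ext rfl <| heq_of_eq <| funext fun _ =>
    OrderHom.ext _ _ <| funext fun p =>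
      (congrArg _ (Hom.app_eqHom f _ p)).trans (LaxData.eqHom_eqHom _ _ _ _)
  comp_id _ := Hom.ext' <| CalcHomData.ext rfl <| heq_of_eq <| funext fun _ =>
    OrderHom.ext _ _ <| funext fun _ => LaxData.eqHom_eqHom _ _ _ _
  assoc _ _ h := Hom.ext' <| CalcHomData.ext rfl <| heq_of_eq <| funext fun _ =>
    OrderHom.ext _ _ <| funext fun _ =>
      ((congrArg _ (Hom.app_eqHom h _ _)).trans (LaxData.eqHom_eqHom _ _ _ _)).trans
        (LaxData.eqHom_eqHom _ _ _ _).symm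

end RgCalc

/-! ### The category of regular categories -/

/-- A (small) regular category. -/
structure RgCat where
  Ob : Type u
  [category : Category.{v} Ob]
  [regular : Regular Ob]

namespace RgCat

instance : CoeSort RgCat.{v, u} (Type u) := ⟨RgCat.Ob⟩

attribute [instance] RgCat.category RgCat.regular

/-- A regular functor: a functor preserving finite limits and regular epimorphisms. -/
structure Hom (R R' : RgCat.{v, u}) where
  functor : R ⥤ R'
  preservesFiniteLimits : PreservesFiniteLimits functor
  map_isRegularEpi {X Y : R} (f : X ⟶ Y) : IsRegularEpi f → IsRegularEpi (functor.map f)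

/-- The category of regular categories and regular functors. -/
instance : Category RgCat.{v, u} where
  Hom := Hom
  id R := ⟨𝟭 R, inferInstance, fun _ h => h⟩
  comp F G := ⟨F.functor ⋙ G.functor,
    have := F.preservesFiniteLimits
    have := G.preservesFiniteLimits
    comp_preservesFiniteLimits _ _,
    fun f h => G.map_isRegularEpi _ (F.map_isRegularEpi f h)⟩

/-- The underlying functor of a morphism of `RgCat`. -/
abbrev toFunctor {R R' : RgCat.{v, u}} (F : R ⟶ R') : R ⥤ R' := Hom.functor F

/-- A choice of finite products. -/
noncomputable instance (R : RgCat.{v, u}) : CartesianMonoidalCategory R := .ofHasFiniteProducts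

variable (R : RgCat.{v, u})

variable {R} in
/-- The support of an object: the image of the unique map to the terminal object. -/
noncomputable def supp (r : R) : R := image (toUnit r)

/-- Any two maps into a support are equal. -/
theorem supp_hom_ext {R : RgCat.{v, u}} {x r : R} (f g : x ⟶ supp r) : f = g := by
  exact (cancel_mono (image.ι (toUnit r))).1 (toUnit_unique _ _)

/-- The counit `⌜−⌝ : FRg(Ob R) ⥤ R`, sending `(n, S, τ)` to
`∏ i, τ i × ∏ s ∈ S, Supp(s)` and acting on morphisms by reindexing the factors. -/
noncomputable def interp : Ctx R ⥤ R where
  obj Γ :=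
    have : Finite Γ.S := Γ.finite_S
    (∏ᶜ fun i : Fin Γ.n => Γ.τ i) ⊗ (∏ᶜ fun s : Γ.S => supp s.1)
  map {Γ Δ} f :=
    have : Finite Γ.S := Γ.finite_S
    have : Finite Δ.S := Δ.finite_S
    (Pi.lift fun i => Pi.π (fun i : Fin Γ.n => Γ.τ i) (f.fn i) ≫ eqToHom (f.comm i)) ⊗ₘ
      (Pi.lift fun s => Pi.π (fun s : Γ.S => supp s.1) ⟨s.1, f.supp_le s.2⟩)
  map_id Γ := by
    have : Finite Γ.S := Γ.finite_S
    refine CartesianMonoidalCategory.hom_ext _ _ ?_ ?_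
    · rw [tensorHom_fst, Category.id_comp]
      refine Eq.trans (congrArg _ ?_) (Category.comp_id _)
      exact Pi.hom_ext _ _ fun i => by simp
    · rw [tensorHom_snd, Category.id_comp]
      refine Eq.trans (congrArg _ ?_) (Category.comp_id _)
      exact Pi.hom_ext _ _ fun s => supp_hom_ext _ _
  map_comp {Γ Δ Θ} f g := by
    have : Finite Γ.S := Γ.finite_S
    have : Finite Δ.S := Δ.finite_S
    have : Finite Θ.S := Θ.finite_S
    rw [tensorHom_comp_tensorHom]
    refine congrArg₂ (fun a b => a ⊗ₘ b) ?_ ?_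
    · exact Pi.hom_ext _ _ fun i => by simp
    · exact Pi.hom_ext _ _ fun s => supp_hom_ext _ _

/-- The data of `prd(R) = (Ob R, Sub_R ∘ ⌜−⌝)`: a context `Γ` is sent to the poset of subobjects of
`⌜Γ⌝`, a relation of contexts acts through the relation in `R` that it induces, and the laxators
are the top subobject of `⌜0⌝` and the products `φ × ψ ⊆ ⌜Γ⌝ × ⌜Δ⌝ ≅ ⌜Γ ⊕ Δ⌝`. -/
noncomputable def prdData : CalcData.{max u v, u} where
  T := R
  P :=
    { obj := fun Γ => PartOrd.of (Subobject (R.interp.obj Γ))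
      map := fun x => (RelHom.map R.interp x).act
      unit := (⊤ : Subobject (R.interp.obj (𝟙_ (Ctx R))))
      lax := fun Γ Δ =>
        { toFun := fun φ => (Subobject.pullback (CartesianMonoidalCategory.prodComparison R.interp Γ Δ)).obj
            ((Subobject.pullback (fst (R.interp.obj Γ) (R.interp.obj Δ))).obj φ.1 ⊓
              (Subobject.pullback (snd (R.interp.obj Γ) (R.interp.obj Δ))).obj φ.2)
          monotone' := fun _ _ h => (Subobject.pullback _).monotone
            (inf_le_inf ((Subobject.pullback _).monotone h.1)
              ((Subobject.pullback _).monotone h.2)) } }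

variable {R} {R' : RgCat.{v, u}} (F : R ⟶ R')

/-- The canonical map `F(Supp r) ⟶ Supp(F r)`, the unique lift in the square formed by the regular
epimorphism `F(r) ⟶ F(Supp r)` and the monomorphism `Supp(F r) ⟶ 1`. -/
noncomputable def suppComparison (r : R) :
    (toFunctor F).obj (supp r) ⟶ supp ((toFunctor F).obj r) :=
  have : IsRegularEpi ((toFunctor F).map (factorThruImage (toUnit r))) :=
    Hom.map_isRegularEpi F _ inferInstance
  have sq : CommSq (factorThruImage (toUnit ((toFunctor F).obj r)))
      ((toFunctor F).map (factorThruImage (toUnit r)))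
      (image.ι (toUnit ((toFunctor F).obj r))) (toUnit _) :=
    ⟨toUnit_unique _ _⟩
  sq.lift

/-- The canonical comparison `F⌜Γ⌝ ⟶ ⌜FRg(Ob F)(Γ)⌝`. Its component at a type `i` of `Γ` is the
image under `F` of the projection to `τ i`; its component at an element of the support `F(S)`,
written as `F(s)` with `s ∈ S`, is the image of the projection to `Supp(s)` followed by
`F(Supp s) ⟶ Supp(F s)` (this does not depend on `s`, as maps into a support are unique). -/
noncomputable def interpComparison (Γ : Ctx R) :
    (toFunctor F).obj (R.interp.obj Γ) ⟶
      R'.interp.obj ((Ctx.map (toFunctor F).obj).obj Γ) :=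
  have : Finite Γ.S := Γ.finite_S
  have : Finite ((Ctx.map (toFunctor F).obj).obj Γ).S := Ctx.finite_S _
  lift
    (Pi.lift fun i : Fin Γ.n => (toFunctor F).map
      (fst (∏ᶜ fun i : Fin Γ.n => Γ.τ i) (∏ᶜ fun s : Γ.S => supp s.1) ≫
        Pi.π (fun i : Fin Γ.n => Γ.τ i) i))
    (Pi.lift fun t : ((Ctx.map (toFunctor F).obj).obj Γ).S =>
      have h : ∃ s, s ∈ Γ.S ∧ (toFunctor F).obj s = t.1 := t.2
      (toFunctor F).map
        (snd (∏ᶜ fun i : Fin Γ.n => Γ.τ i) (∏ᶜ fun s : Γ.S => supp s.1) ≫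
          Pi.π (fun s : Γ.S => supp s.1) ⟨h.choose, h.choose_spec.1⟩) ≫
        suppComparison F h.choose ≫ eqToHom (congrArg supp h.choose_spec.2))

/-- The data of `prd(F) = (Ob F, Sub_F)`: the subobject `φ ⊆ ⌜Γ⌝` is sent to the subobject
`F(φ) ⊆ F⌜Γ⌝ ≅ ⌜FRg(Ob F)(Γ)⌝`. -/
noncomputable def prdMapData : CalcHomData R.prdData R'.prdData where
  toFun := (toFunctor F).obj
  app Γ :=
    { toFun := fun (φ : Subobject (R.interp.obj Γ)) =>
        (imageSubobject ((toFunctor F).map φ.arrow ≫ interpComparison F Γ) :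
          Subobject (R'.interp.obj ((Ctx.map (toFunctor F).obj).obj Γ)))
      monotone' := fun (φ ψ : Subobject (R.interp.obj Γ)) (h : φ ≤ ψ) => by
        have e : (toFunctor F).map φ.arrow ≫ interpComparison F Γ =
            (toFunctor F).map (Subobject.ofLE φ ψ h) ≫
              (toFunctor F).map ψ.arrow ≫ interpComparison F Γ := by
          rw [← Category.assoc, ← Functor.map_comp, Subobject.ofLE_arrow]
        change imageSubobject _ ≤ imageSubobject _
        simp only [e]
        exact imageSubobject_comp_le _ _ }

end RgCat

end GraphicalRegularLogic

/-! Everything is computed with generalised elements. A subobject is known by the maps `z : W ⟶ X`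
that factor through it; pulling back is composition, meets are conjunctions, and an image contains
`z` exactly when `z` lifts after precomposition with some regular epimorphism, that is, locally on
`W`. Equations between subobjects thereby become statements of regular logic.

For `prd(R)` to be a regular calculus, little is needed of `⌜−⌝`: it preserves pairs, the terminal
object, regular epimorphisms, and pullbacks weakly (`PreservesRel`, `SubLax.isAjax`). An element of
`⌜Γ⌝` is a tuple of elements of the types of `Γ`, at a stage where every support listed in `Γ` is
inhabited. A regular epimorphism of contexts drops variables and keeps the support, so the dropped
variables can be refilled locally. Two elements that agree over a third context come from one
context, whose variables are the values that occur in them. A regular functor `F` preserves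
pullbacks, meets and images, and commutes with `⌜−⌝` up to a natural isomorphism, so it acts on
these calculi (`SubLax.isMonoidalNat_mapApp`).

For fullness, take a morphism of calculi. Naturality at graphs and at converse graphs says that its
action on subobjects preserves `∃` and substitution along morphisms of contexts; compatibility with
the laxators adds `⊤` and `∧` (`SubLax.isLogical`). An arbitrary morphism `⌜Γ⌝ ⟶ ⌜Δ⌝` has a graph, a
relation that is total and single-valued. Both properties are expressed in the preserved logic, so
the graph is sent to the graph of a unique morphism (`IsLogical.exists_extend`). Composition,
monomorphisms, regular epimorphisms and pullbacks are expressible as well, and every object is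
isomorphic to the interpretation of a one-variable context, so a regular functor results
(`RgCat.ofHom`). It induces the given morphism because every subobject is the image of a morphism
from a one-variable context (`RgCat.prdMap_ofHom`).

For faithfulness, the same construction applied to `prd(F)` returns `F`, since the graph of `f` is
sent to the graph of `F f` up to the comparison isomorphisms (`RgCat.ofHom_prdMap`). -/

namespace GraphicalRegularLogic

/-! ### Generalised elements of subobjects -/

section Elements

variable {C : Type*} [Category* C]

theorem Subobject.le_iff_factors {X : C} {φ ψ : Subobject X} :
    φ ≤ ψ ↔ ∀ (W : C) (z : W ⟶ X), φ.Factors z → ψ.Factors z :=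
  ⟨fun h _ _ hz => Subobject.factors_of_le _ h hz,
    fun h => Subobject.le_of_factors (h _ _ (Subobject.factors_self φ))⟩

theorem Subobject.ext_factors {X : C} {φ ψ : Subobject X}
    (h : ∀ (W : C) (z : W ⟶ X), φ.Factors z ↔ ψ.Factors z) : φ = ψ :=
  le_antisymm (Subobject.le_iff_factors.2 fun W z => (h W z).1)
    (Subobject.le_iff_factors.2 fun W z => (h W z).2)

theorem Subobject.factors_iff_exists {X W : C} {φ : Subobject X} {z : W ⟶ X} :
    φ.Factors z ↔ ∃ y : W ⟶ (φ : C), y ≫ φ.arrow = z :=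
  ⟨fun h => ⟨φ.factorThru z h, Subobject.factorThru_arrow _ _ h⟩,
    fun ⟨y, hy⟩ => hy ▸ Subobject.factors_comp_arrow y⟩

theorem Subobject.factors_pullback_iff [HasPullbacks C] {X Y W : C} (f : X ⟶ Y)
    {φ : Subobject Y} {z : W ⟶ X} :
    ((Subobject.pullback f).obj φ).Factors z ↔ φ.Factors (z ≫ f) := by
  rw [Subobject.factors_iff_exists, Subobject.factors_iff_exists]
  have sq := Subobject.isPullback f φ
  constructor
  · rintro ⟨y, rfl⟩
    exact ⟨y ≫ Subobject.pullbackπ f φ, by rw [Category.assoc, Category.assoc, sq.w]⟩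
  · rintro ⟨y, hy⟩
    exact ⟨sq.lift y z hy, sq.lift_snd _ _ _⟩

/-- The lifting of a morphism through a monomorphism can be tested after a regular epimorphism. -/
theorem exists_lift_of_cover {X A W W' : C} (m : A ⟶ X) [Mono m] (e : W' ⟶ W) [IsRegularEpi e]
    {z : W ⟶ X} (h : ∃ y, y ≫ m = e ≫ z) : ∃ y, y ≫ m = z := by
  obtain ⟨y, hy⟩ := h
  -- A regular epimorphism is strong, so this square against a monomorphism has a diagonal.
  have sq : CommSq y e m z := ⟨hy⟩
  exact ⟨sq.lift, sq.fac_right⟩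

theorem Subobject.factors_cover_iff {X W W' : C} {φ : Subobject X} (e : W' ⟶ W) [IsRegularEpi e]
    {z : W ⟶ X} : φ.Factors (e ≫ z) ↔ φ.Factors z :=
  ⟨fun h => Subobject.factors_iff_exists.2
    (exists_lift_of_cover φ.arrow e (Subobject.factors_iff_exists.1 h)),
    fun h => Subobject.factors_of_factors_right e h⟩

/-- A property of generalised elements holds locally at `z` if it holds for the composite of `z`
with some regular epimorphism. -/
def Locally {W : C} (p : ∀ {W' : C}, (W' ⟶ W) → Prop) : Prop :=
  ∃ (W' : C) (e : W' ⟶ W), IsRegularEpi e ∧ p e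

theorem isRegularEpi_id (X : C) : IsRegularEpi (𝟙 X) := inferInstance

theorem Locally.of_id {W : C} {p : ∀ {W' : C}, (W' ⟶ W) → Prop} (h : p (𝟙 W)) : Locally p :=
  ⟨W, 𝟙 W, isRegularEpi_id W, h⟩

theorem Locally.mono {W : C} {p q : ∀ {W' : C}, (W' ⟶ W) → Prop} (h : Locally p)
    (hpq : ∀ {W' : C} (e : W' ⟶ W), p e → q e) : Locally q := by
  obtain ⟨W', e, he, h⟩ := h
  exact ⟨W', e, he, hpq e h⟩

section Regular

variable [Regular C]

theorem isRegularEpi_comp {X Y Z : C} (e : X ⟶ Y) (f : Y ⟶ Z) (he : IsRegularEpi e)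
    (hf : IsRegularEpi f) : IsRegularEpi (e ≫ f) := by
  have : StrongEpi (e ≫ f) := strongEpi_comp e f
  infer_instance

theorem isRegularEpi_of_comp {X Y Z : C} (e : X ⟶ Y) (f : Y ⟶ Z) (h : IsRegularEpi (e ≫ f)) :
    IsRegularEpi f := by
  have : StrongEpi (e ≫ f) := inferInstance
  have : StrongEpi f := strongEpi_of_strongEpi e f
  infer_instance

theorem Locally.trans {W : C} {p q : ∀ {W' : C}, (W' ⟶ W) → Prop} (h : Locally p)
    (hpq : ∀ {W' : C} (e : W' ⟶ W), p e → Locally (fun {_} e' => q (e' ≫ e))) : Locally q := by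
  obtain ⟨W', e, he, h⟩ := h
  obtain ⟨W'', e', he', h'⟩ := hpq e h
  exact ⟨W'', e' ≫ e, isRegularEpi_comp _ _ he' he, h'⟩

/-- Two local properties, stable under restriction, hold locally at the same time. -/
theorem Locally.and {W : C} {p q : ∀ {W' : C}, (W' ⟶ W) → Prop} (hp : Locally p) (hq : Locally q)
    (hp' : ∀ {W' W'' : C} (e : W' ⟶ W) (d : W'' ⟶ W'), p e → p (d ≫ e))
    (hq' : ∀ {W' W'' : C} (e : W' ⟶ W) (d : W'' ⟶ W'), q e → q (d ≫ e)) :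
    Locally (fun {_} e => p e ∧ q e) := by
  obtain ⟨W₁, e₁, he₁, h₁⟩ := hp
  obtain ⟨W₂, e₂, he₂, h₂⟩ := hq
  -- The common refinement of two covers is their pullback; it is a cover because regular
  -- epimorphisms are stable under pullback and composition.
  refine ⟨pullback e₁ e₂, pullback.fst e₁ e₂ ≫ e₁, isRegularEpi_comp _ _ inferInstance he₁,
    hp' _ _ h₁, ?_⟩
  rw [pullback.condition]
  exact hq' _ _ h₂

/-- A cover of a generalised element of the codomain of a regular epimorphism on which the element
lifts. -/
theorem Locally.lift {X Y W : C} (f : X ⟶ Y) (hf : IsRegularEpi f) (z : W ⟶ Y) :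
    Locally (fun {W'} e => ∃ y : W' ⟶ X, y ≫ f = e ≫ z) :=
  ⟨pullback f z, pullback.snd f z, inferInstance, pullback.fst f z, pullback.condition⟩

theorem isRegularEpi_of_locally {X Y : C} (f : X ⟶ Y)
    (h : Locally (fun {W'} e => ∃ y : W' ⟶ X, y ≫ f = e)) : IsRegularEpi f := by
  obtain ⟨W', e, he, y, rfl⟩ := h
  exact isRegularEpi_of_comp _ _ he

theorem isRegularEpi_factorThruImageSubobject {X Y : C} (f : X ⟶ Y) :
    IsRegularEpi (factorThruImageSubobject f) := by
  have : StrongEpi (factorThruImageSubobject f) := by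
    unfold factorThruImageSubobject; exact strongEpi_comp _ _
  infer_instance

/-- The existential clause of the local semantics. An element of the image lifts on the pullback of
the regular epimorphism onto the image; conversely, membership descends along covers. -/
theorem Subobject.factors_imageSubobject_iff {X Y W : C} (f : X ⟶ Y) {z : W ⟶ Y} :
    (imageSubobject f).Factors z ↔ Locally (fun {W'} e => ∃ y : W' ⟶ X, y ≫ f = e ≫ z) := by
  constructor
  · intro h
    obtain ⟨y, rfl⟩ := Subobject.factors_iff_exists.1 h
    refine (Locally.lift _ (isRegularEpi_factorThruImageSubobject f) y).mono ?_
    rintro W' e ⟨x, hx⟩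
    exact ⟨x, by rw [← reassoc_of% hx, imageSubobject_arrow_comp]⟩
  · rintro ⟨W', e, he, y, hy⟩
    rw [← Subobject.factors_cover_iff e, ← hy]
    exact imageSubobject_factors_comp_self f y

/-- Both sides are the least subobject whose pullback along `f` contains `φ`, so the adjunction
determines the answer. -/
theorem Subobject.exists_eq_imageSubobject {X Y : C} (f : X ⟶ Y) (φ : Subobject X) :
    (Subobject.exists f).obj φ = imageSubobject (φ.arrow ≫ f) := by
  have adj : ∀ ψ, (Subobject.exists f).obj φ ≤ ψ ↔ φ ≤ (Subobject.pullback f).obj ψ :=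
    fun ψ => (Subobject.existsPullbackAdj f).gc φ ψ
  refine le_antisymm ?_ ?_
  · rw [adj]
    refine Subobject.le_of_factors ?_
    rw [Subobject.factors_pullback_iff]
    simpa using imageSubobject_factors_comp_self (φ.arrow ≫ f) (𝟙 _)
  · have h := (adj _).1 le_rfl
    have h' := Subobject.factors_of_le _ h (Subobject.factors_self φ)
    rw [Subobject.factors_pullback_iff] at h'
    exact imageSubobject_le _ (Subobject.factorThru _ _ h') (Subobject.factorThru_arrow _ _ h')

theorem Subobject.factors_exists_iff {X Y W : C} (f : X ⟶ Y) {φ : Subobject X} {z : W ⟶ Y} :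
    ((Subobject.exists f).obj φ).Factors z ↔
      Locally (fun {W'} e => ∃ y : W' ⟶ X, φ.Factors y ∧ y ≫ f = e ≫ z) := by
  rw [Subobject.exists_eq_imageSubobject, Subobject.factors_imageSubobject_iff]
  constructor
  · intro h
    refine h.mono ?_
    rintro W' e ⟨y, hy⟩
    exact ⟨y ≫ φ.arrow, Subobject.factors_comp_arrow y, by rw [Category.assoc, hy]⟩
  · intro h
    refine h.mono ?_
    rintro W' e ⟨y, hy, hy'⟩
    exact ⟨φ.factorThru y hy, by rw [Subobject.factorThru_arrow_assoc, hy']⟩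

theorem Subobject.exists_le_iff {X Y : C} (f : X ⟶ Y) (φ : Subobject X) (ψ : Subobject Y) :
    (Subobject.exists f).obj φ ≤ ψ ↔ φ ≤ (Subobject.pullback f).obj ψ :=
  (Subobject.existsPullbackAdj f).gc φ ψ

theorem Subobject.exists_iso {X Y : C} (f : X ⟶ Y) [IsIso f] (φ : Subobject X) :
    (Subobject.exists f).obj φ = (Subobject.pullback (inv f)).obj φ := by
  refine Subobject.ext_factors fun W z => ?_
  rw [Subobject.factors_exists_iff, Subobject.factors_pullback_iff]
  constructor
  · rintro ⟨W', e, he, y, hy, hy'⟩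
    rw [← Subobject.factors_cover_iff e, ← Category.assoc, ← hy']
    simpa using hy
  · intro h
    exact Locally.of_id ⟨z ≫ inv f, h, by simp⟩

/-- Turns regular epimorphisms into an equation between subobjects, which a map preserving `∃` and
`⊤` can transport. -/
theorem isRegularEpi_iff_exists_top {X Y : C} (f : X ⟶ Y) :
    IsRegularEpi f ↔ (Subobject.exists f).obj ⊤ = ⊤ := by
  constructor
  · intro hf
    refine Subobject.ext_factors fun W z => ?_
    rw [Subobject.factors_exists_iff]
    exact ⟨fun _ => Subobject.top_factors _, fun _ => (Locally.lift f hf z).mono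
      fun e ⟨y, hy⟩ => ⟨y, Subobject.top_factors _, hy⟩⟩
  · intro h
    have h' : ((Subobject.exists f).obj ⊤).Factors (𝟙 Y) := h ▸ Subobject.top_factors _
    rw [Subobject.factors_exists_iff] at h'
    refine isRegularEpi_of_locally f (h'.mono ?_)
    rintro W' e ⟨y, -, hy⟩
    exact ⟨y, by rw [hy, Category.comp_id]⟩

end Regular

end Elements

/-! ### The action of relations on generalised elements -/

namespace RelHom

variable {C : Type u} [Category.{v} C] [CartesianMonoidalCategory C] [Regular C]
  {X Y A : C}

theorem factors_act_iff (x : RelHom X Y) (φ : Subobject X) {W : C} (z : W ⟶ Y) :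
    (x.act φ).Factors z ↔ Locally (fun {W'} e => ∃ a : W' ⟶ (x : C),
      φ.Factors (a ≫ x.src) ∧ a ≫ x.tgt = e ≫ z) := by
  refine (Subobject.factors_exists_iff _).trans ?_
  constructor <;> refine fun h => h.mono ?_ <;> rintro W' e ⟨y, hy, hy'⟩ <;>
    exact ⟨y, by simpa [Subobject.factors_pullback_iff] using hy, hy'⟩

/-- The apex of a span covers the relation it presents, so witnesses in the relation lift locally to
the apex. Hence any presenting span computes the action. -/
theorem factors_act_ofSpan_iff (f : A ⟶ X) (g : A ⟶ Y) (φ : Subobject X) {W : C} (z : W ⟶ Y) :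
    ((ofSpan f g).act φ).Factors z ↔ Locally (fun {W'} e => ∃ a : W' ⟶ A,
      φ.Factors (a ≫ f) ∧ a ≫ g = e ≫ z) := by
  obtain ⟨c, hc, h₁, h₂⟩ := exists_cover f g
  rw [factors_act_iff]
  constructor
  · intro h
    refine h.trans ?_
    rintro W' e ⟨a, ha, ha'⟩
    refine (Locally.lift c hc a).mono ?_
    rintro W'' e' ⟨b, hb⟩
    refine ⟨b, ?_, ?_⟩
    · rw [← h₁, reassoc_of% hb]
      exact Subobject.factors_of_factors_right e' ha
    · rw [← h₂, reassoc_of% hb, ha', Category.assoc]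
  · intro h
    refine h.mono ?_
    rintro W' e ⟨a, ha, ha'⟩
    exact ⟨a ≫ c, by rwa [Category.assoc, h₁], by rw [Category.assoc, h₂, ha']⟩

theorem act_graph (f : X ⟶ Y) (φ : Subobject X) :
    (graph f).act φ = (Subobject.exists f).obj φ := by
  refine Subobject.ext_factors fun W z => ?_
  unfold graph
  rw [factors_act_ofSpan_iff, Subobject.factors_exists_iff]
  simp

/-- A converse graph acts by substitution, as a graph acts by `∃`. Naturality with respect to
relations thus controls both operations. -/
theorem act_ofSpan_id (f : Y ⟶ X) (φ : Subobject X) :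
    (ofSpan f (𝟙 Y)).act φ = (Subobject.pullback f).obj φ := by
  refine Subobject.ext_factors fun W z => ?_
  rw [factors_act_ofSpan_iff, Subobject.factors_pullback_iff]
  constructor
  · rintro ⟨W', e, he, a, ha, ha'⟩
    rw [Category.comp_id] at ha'
    subst ha'
    rw [← Subobject.factors_cover_iff e]
    simpa using ha
  · exact fun h => Locally.of_id ⟨z, h, by simp⟩

end RelHom

/-! ### Subobjects along a functor into a regular category -/

section SubLax

variable {C : Type u} [Category.{v} C] [CartesianMonoidalCategory C] [Regular C]
  {D : Type*} [Category* D] [CartesianMonoidalCategory D] [Regular D]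

/-- A functor preserves pairs if generalised elements of `J (X ⊗ Y)` are pairs of generalised
elements and `J (𝟙_ C)` has exactly one generalised element at each stage. -/
structure PreservesPairs {C : Type*} [Category* C] [CartesianMonoidalCategory C]
    {D : Type*} [Category* D] (J : C ⥤ D) : Prop where
  exists_pair {X Y : C} {W : D} (p : W ⟶ J.obj X) (q : W ⟶ J.obj Y) :
    ∃ r : W ⟶ J.obj (X ⊗ Y), r ≫ J.map (fst X Y) = p ∧ r ≫ J.map (snd X Y) = q
  pair_ext {X Y : C} {W : D} {p q : W ⟶ J.obj (X ⊗ Y)}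
    (h₁ : p ≫ J.map (fst X Y) = q ≫ J.map (fst X Y))
    (h₂ : p ≫ J.map (snd X Y) = q ≫ J.map (snd X Y)) : p = q
  exists_unit (W : D) : Nonempty (W ⟶ J.obj (𝟙_ C))
  unit_ext {W : D} (p q : W ⟶ J.obj (𝟙_ C)) : p = q

/-- A functor between regular categories preserves the structure of relations if it preserves
binary products, regular epimorphisms, and weakly preserves pullbacks. -/
structure PreservesRel (J : C ⥤ D) : Prop extends PreservesPairs J where
  map_isRegularEpi {X Y : C} (f : X ⟶ Y) : IsRegularEpi f → IsRegularEpi (J.map f)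
  exists_pullback {X Y Z : C} (f : X ⟶ Z) (g : Y ⟶ Z) {W : D} (p : W ⟶ J.obj X) (q : W ⟶ J.obj Y)
    (h : p ≫ J.map f = q ≫ J.map g) :
    ∃ r : W ⟶ J.obj (pullback f g), r ≫ J.map (pullback.fst f g) = p ∧
      r ≫ J.map (pullback.snd f g) = q

/-- The data of the composite of `J` with the lax monoidal po-functor of subobjects. -/
noncomputable def subLax {D : Type u} [Category.{v} D] [CartesianMonoidalCategory D] [Regular D]
    {C : Type*} [Category* C] [CartesianMonoidalCategory C] [Regular C]
    (J : C ⥤ D) : LaxData.{max u v} C where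
  obj X := PartOrd.of (Subobject (J.obj X))
  map x := (RelHom.map J x).act
  unit := (⊤ : Subobject (J.obj (𝟙_ C)))
  lax X Y :=
    { toFun := fun φ =>
        (Subobject.pullback (CartesianMonoidalCategory.prodComparison J X Y)).obj
          ((Subobject.pullback (fst (J.obj X) (J.obj Y))).obj φ.1 ⊓
            (Subobject.pullback (snd (J.obj X) (J.obj Y))).obj φ.2)
      monotone' := fun _ _ h => (Subobject.pullback _).monotone
        (inf_le_inf ((Subobject.pullback _).monotone h.1)
          ((Subobject.pullback _).monotone h.2)) }

end SubLax

namespace SubLax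

variable {D : Type u} [Category.{v} D] [CartesianMonoidalCategory D] [Regular D]
    {C : Type*} [Category* C] [CartesianMonoidalCategory C] [Regular C]
    {J : C ⥤ D}

/-- The action of the subobject po-functor on relations, as a map of subobjects. -/
noncomputable def act (J : C ⥤ D) {X Y : C} (x : RelHom X Y) :
    Subobject (J.obj X) →o Subobject (J.obj Y) :=
  (subLax J).map x

/-- The laxator of the subobject po-functor, as a map of subobjects. -/
noncomputable def prod (J : C ⥤ D) {X Y : C} (φ : Subobject (J.obj X))
    (ψ : Subobject (J.obj Y)) : Subobject (J.obj (X ⊗ Y)) :=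
  (subLax J).lax X Y (φ, ψ)

theorem factors_prod_iff {X Y : C} (φ : Subobject (J.obj X)) (ψ : Subobject (J.obj Y))
    {W : D} (z : W ⟶ J.obj (X ⊗ Y)) :
    (prod J φ ψ).Factors z ↔ φ.Factors (z ≫ J.map (fst X Y)) ∧ ψ.Factors (z ≫ J.map (snd X Y)) := by
  refine (Subobject.factors_pullback_iff _).trans ?_
  rw [Subobject.inf_factors, Subobject.factors_pullback_iff, Subobject.factors_pullback_iff]
  simp

theorem factors_act_iff {X Y : C} (x : RelHom X Y) (φ : Subobject (J.obj X)) {W : D}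
    (z : W ⟶ J.obj Y) :
    (act J x φ).Factors z ↔ Locally (fun {W'} e => ∃ a : W' ⟶ J.obj (x : C),
      φ.Factors (a ≫ J.map x.src) ∧ a ≫ J.map x.tgt = e ≫ z) :=
  RelHom.factors_act_ofSpan_iff _ _ _ _

theorem factors_act_ofSpan_iff
    (hJ : ∀ {X Y : C} (f : X ⟶ Y), IsRegularEpi f → IsRegularEpi (J.map f)) {X Y A : C}
    (f : A ⟶ X) (g : A ⟶ Y) (φ : Subobject (J.obj X)) {W : D} (z : W ⟶ J.obj Y) :
    (act J (RelHom.ofSpan f g) φ).Factors z ↔ Locally (fun {W'} e => ∃ a : W' ⟶ J.obj A,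
      φ.Factors (a ≫ J.map f) ∧ a ≫ J.map g = e ≫ z) := by
  have : act J (RelHom.ofSpan f g) φ = (RelHom.ofSpan (J.map f) (J.map g)).act φ :=
    congrArg (fun x => RelHom.act x φ) (RelHom.map_ofSpan J hJ f g)
  rw [this, RelHom.factors_act_ofSpan_iff]

theorem act_graph
    (hJ : ∀ {X Y : C} (f : X ⟶ Y), IsRegularEpi f → IsRegularEpi (J.map f)) {X Y : C}
    (f : X ⟶ Y) (φ : Subobject (J.obj X)) :
    act J (RelHom.graph f) φ = (Subobject.exists (J.map f)).obj φ :=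
  (congrArg (fun x => RelHom.act x φ) (RelHom.map_graph J hJ f)).trans (RelHom.act_graph _ _)

theorem act_ofSpan_id
    (hJ : ∀ {X Y : C} (f : X ⟶ Y), IsRegularEpi f → IsRegularEpi (J.map f)) {X Y : C}
    (f : Y ⟶ X) (φ : Subobject (J.obj X)) :
    act J (RelHom.ofSpan f (𝟙 Y)) φ = (Subobject.pullback (J.map f)).obj φ := by
  refine (congrArg (fun x => RelHom.act x φ) (RelHom.map_ofSpan J hJ f (𝟙 Y))).trans ?_
  rw [J.map_id]
  exact RelHom.act_ofSpan_id _ _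

theorem act_graph_iso
    (hJ : ∀ {X Y : C} (f : X ⟶ Y), IsRegularEpi f → IsRegularEpi (J.map f)) {X Y : C}
    (f : X ≅ Y) (φ : Subobject (J.obj X)) {W : D} (z : W ⟶ J.obj Y) :
    (act J (RelHom.graph f.hom) φ).Factors z ↔ φ.Factors (z ≫ J.map f.inv) := by
  have : inv (J.map f.hom) = J.map f.inv := (IsIso.eq_inv_of_hom_inv_id (by simp)).symm
  rw [act_graph hJ, Subobject.exists_iso, Subobject.factors_pullback_iff, this]

/-- Both sides assert the local existence of a composable pair of witnesses. Only existence matters,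
so weak preservation of the pullback suffices. -/
theorem act_comp (hJ : PreservesRel J) {X Y Z : C} (x : RelHom X Y) (y : RelHom Y Z)
    (φ : Subobject (J.obj X)) : act J (x.comp y) φ = act J y (act J x φ) := by
  refine Subobject.ext_factors fun W z => ?_
  unfold RelHom.comp
  rw [factors_act_ofSpan_iff hJ.map_isRegularEpi, factors_act_iff]
  constructor
  · intro h
    refine h.mono ?_
    rintro W' e ⟨a, ha, ha'⟩
    refine ⟨a ≫ J.map (pullback.snd _ _), ?_, by simpa using ha'⟩
    rw [factors_act_iff]
    refine Locally.of_id ⟨a ≫ J.map (pullback.fst _ _), by simpa using ha, ?_⟩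
    simp only [Category.assoc, ← J.map_comp, pullback.condition, Category.id_comp]
  · intro h
    refine h.trans ?_
    rintro W' e ⟨a, ha, ha'⟩
    rw [factors_act_iff] at ha
    refine ha.mono ?_
    rintro W'' e' ⟨b, hb, hb'⟩
    obtain ⟨r, rfl, hr'⟩ := hJ.exists_pullback x.tgt y.src b (e' ≫ a) (by simpa using hb')
    refine ⟨r, by simpa using hb, ?_⟩
    rw [J.map_comp, reassoc_of% hr', ha', Category.assoc]

theorem act_tensor (hJ : PreservesRel J) {X Y X' Y' : C} (x : RelHom X Y) (x' : RelHom X' Y')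
    (φ : Subobject (J.obj X)) (φ' : Subobject (J.obj X')) :
    act J (x.tensor x') (prod J φ φ') = prod J (act J x φ) (act J x' φ') := by
  refine Subobject.ext_factors fun W z => ?_
  unfold RelHom.tensor
  rw [factors_act_ofSpan_iff hJ.map_isRegularEpi, factors_prod_iff, factors_act_iff,
    factors_act_iff]
  constructor
  · intro h
    constructor <;> refine h.mono ?_ <;> rintro W' e ⟨a, ha, ha'⟩ <;> rw [factors_prod_iff] at ha
    · refine ⟨a ≫ J.map (fst _ _), ?_, ?_⟩
      · simpa only [Category.assoc, ← J.map_comp, tensorHom_fst] using ha.1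
      · rw [← reassoc_of% ha', ← J.map_comp, tensorHom_fst, J.map_comp, Category.assoc]
    · refine ⟨a ≫ J.map (snd _ _), ?_, ?_⟩
      · simpa only [Category.assoc, ← J.map_comp, tensorHom_snd] using ha.2
      · rw [← reassoc_of% ha', ← J.map_comp, tensorHom_snd, J.map_comp, Category.assoc]
  · rintro ⟨h, h'⟩
    -- The two witnesses live on different covers; on a common refinement they can be paired.
    refine (h.and h' ?_ ?_).mono ?_
    · rintro W' W'' e d ⟨a, ha, ha'⟩
      exact ⟨d ≫ a, by simpa using Subobject.factors_of_factors_right d ha, by simp [ha']⟩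
    · rintro W' W'' e d ⟨a, ha, ha'⟩
      exact ⟨d ≫ a, by simpa using Subobject.factors_of_factors_right d ha, by simp [ha']⟩
    · rintro W' e ⟨⟨a, ha, ha'⟩, ⟨b, hb, hb'⟩⟩
      obtain ⟨r, rfl, rfl⟩ := hJ.exists_pair a b
      refine ⟨r, ?_, hJ.pair_ext ?_ ?_⟩
      · rw [factors_prod_iff]
        refine ⟨?_, ?_⟩
        · simpa only [Category.assoc, ← J.map_comp, tensorHom_fst] using ha
        · simpa only [Category.assoc, ← J.map_comp, tensorHom_snd] using hb
      · simpa only [Category.assoc, ← J.map_comp, tensorHom_fst] using ha'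
      · simpa only [Category.assoc, ← J.map_comp, tensorHom_snd] using hb'

theorem prod_eq_inf {X Y : C} (φ : Subobject (J.obj X)) (ψ : Subobject (J.obj Y)) :
    prod J φ ψ = (Subobject.pullback (J.map (fst X Y))).obj φ ⊓
      (Subobject.pullback (J.map (snd X Y))).obj ψ :=
  Subobject.ext_factors fun W z => by
    rw [factors_prod_iff, Subobject.inf_factors, Subobject.factors_pullback_iff,
      Subobject.factors_pullback_iff]

theorem act_id (hJ : PreservesRel J) (X : C) (φ : Subobject (J.obj X)) :
    act J (RelHom.id X) φ = φ := by
  refine (act_graph hJ.map_isRegularEpi (𝟙 X) φ).trans (Subobject.ext_factors fun W z => ?_)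
  rw [J.map_id, Subobject.exists_iso, Subobject.factors_pullback_iff, IsIso.inv_id,
    Category.comp_id]

theorem act_mono {X Y : C} {x x' : RelHom X Y} (h : x ≤ x') (φ : Subobject (J.obj X)) :
    act J x φ ≤ act J x' φ := by
  refine Subobject.le_iff_factors.2 fun W z => ?_
  refine fun hz => (factors_act_iff x' φ z).2 (((factors_act_iff x φ z).1 hz).mono ?_)
  rintro W' e ⟨a, ha, ha'⟩
  have h₁ : Subobject.ofLE x x' h ≫ x'.src = x.src := by simp [RelHom.src]
  have h₂ : Subobject.ofLE x x' h ≫ x'.tgt = x.tgt := by simp [RelHom.tgt]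
  exact ⟨a ≫ J.map (Subobject.ofLE x x' h),
    by rwa [Category.assoc, ← J.map_comp, h₁], by rwa [Category.assoc, ← J.map_comp, h₂]⟩

theorem act_associator (hJ : PreservesRel J) {X Y Z : C} (φ : Subobject (J.obj X))
    (ψ : Subobject (J.obj Y)) (χ : Subobject (J.obj Z)) :
    act J (RelHom.graph (α_ X Y Z).hom) (prod J (prod J φ ψ) χ) = prod J φ (prod J ψ χ) := by
  refine Subobject.ext_factors fun W z => ?_
  rw [act_graph_iso hJ.map_isRegularEpi]
  simp only [factors_prod_iff, Category.assoc, ← J.map_comp, associator_inv_fst_fst,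
    associator_inv_fst_snd, associator_inv_snd, and_assoc]

theorem act_leftUnitor (hJ : PreservesRel J) {X : C} (φ : Subobject (J.obj X)) :
    act J (RelHom.graph (λ_ X).hom) (prod J (⊤ : Subobject (J.obj (𝟙_ C))) φ) = φ := by
  refine Subobject.ext_factors fun W z => ?_
  rw [act_graph_iso hJ.map_isRegularEpi]
  simp only [factors_prod_iff, Category.assoc, ← J.map_comp, leftUnitor_inv_snd, J.map_id,
    Category.comp_id, Subobject.top_factors, true_and]

theorem act_rightUnitor (hJ : PreservesRel J) {X : C} (φ : Subobject (J.obj X)) :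
    act J (RelHom.graph (ρ_ X).hom) (prod J φ (⊤ : Subobject (J.obj (𝟙_ C)))) = φ := by
  refine Subobject.ext_factors fun W z => ?_
  rw [act_graph_iso hJ.map_isRegularEpi]
  simp only [factors_prod_iff, Category.assoc, ← J.map_comp, rightUnitor_inv_fst, J.map_id,
    Category.comp_id, Subobject.top_factors, and_true]

theorem act_braiding (hJ : PreservesRel J) {X Y : C} (φ : Subobject (J.obj X))
    (ψ : Subobject (J.obj Y)) :
    act J (RelHom.graph (lift (snd X Y) (fst X Y))) (prod J φ ψ) = prod J ψ φ := by
  let s : X ⊗ Y ≅ Y ⊗ X :=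
    ⟨lift (snd X Y) (fst X Y), lift (snd Y X) (fst Y X),
      by apply CartesianMonoidalCategory.hom_ext <;> simp,
      by apply CartesianMonoidalCategory.hom_ext <;> simp⟩
  refine Subobject.ext_factors fun W z => (act_graph_iso hJ.map_isRegularEpi s _ z).trans ?_
  simp only [factors_prod_iff, Category.assoc, ← J.map_comp, s, lift_fst, lift_snd, and_comm]

/-- `φ × ψ` is the meet of two pullbacks along projections, so the pair of images along these
projections is left adjoint to the laxator. -/
theorem prod_adjunction {X Y : C} (θ : Subobject (J.obj (X ⊗ Y))) (φ : Subobject (J.obj X))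
    (ψ : Subobject (J.obj Y)) :
    (Subobject.exists (J.map (fst X Y))).obj θ ≤ φ ∧ (Subobject.exists (J.map (snd X Y))).obj θ ≤ ψ ↔
      θ ≤ prod J φ ψ := by
  rw [prod_eq_inf, le_inf_iff]
  exact and_congr (Subobject.exists_le_iff _ _ _) (Subobject.exists_le_iff _ _ _)

theorem isAjax (hJ : PreservesRel J) : (subLax J).IsAjax where
  map_id X := OrderHom.ext _ _ <| funext fun φ => act_id hJ X φ
  map_comp x y := OrderHom.ext _ _ <| funext fun φ => act_comp hJ x y φ
  map_mono h := fun φ => act_mono h φ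
  lax_natural x x' φ φ' := act_tensor hJ x x' φ φ'
  lax_assoc φ ψ χ := act_associator hJ φ ψ χ
  lax_left_unit φ := act_leftUnitor hJ φ
  lax_right_unit φ := act_rightUnitor hJ φ
  lax_symm φ ψ := act_braiding hJ φ ψ
  unit_adj := ⟨⟨fun _ => PUnit.unit, fun _ _ _ => le_rfl⟩, fun _ _ =>
    ⟨fun _ => le_top (α := Subobject (J.obj (𝟙_ C))), fun _ => le_rfl⟩⟩
  lax_adj X Y := ⟨⟨fun (θ : Subobject (J.obj (X ⊗ Y))) =>
      ((Subobject.exists (J.map (fst X Y))).obj θ, (Subobject.exists (J.map (snd X Y))).obj θ),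
      fun _ _ h => ⟨(Subobject.exists _).monotone h, (Subobject.exists _).monotone h⟩⟩,
    fun θ φ => prod_adjunction θ φ.1 φ.2⟩

end SubLax

namespace RgCat

/-! ### Generalised elements of the interpretation of a context -/

section Points

variable {R : RgCat.{v, u}}

/-- The projection of `⌜Γ⌝` to the type of one of its variables. -/
noncomputable def proj (Γ : Ctx R) (i : Fin Γ.n) : R.interp.obj Γ ⟶ Γ.τ i :=
  have : Finite Γ.S := Γ.finite_S
  fst (∏ᶜ fun i : Fin Γ.n => Γ.τ i) (∏ᶜ fun s : Γ.S => supp s.1) ≫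
    Pi.π (fun i : Fin Γ.n => Γ.τ i) i

/-- The projection of `⌜Γ⌝` to the support of one of its types. -/
noncomputable def projSupp (Γ : Ctx R) (s : R) (hs : s ∈ Γ.S) : R.interp.obj Γ ⟶ supp s :=
  have : Finite Γ.S := Γ.finite_S
  snd (∏ᶜ fun i : Fin Γ.n => Γ.τ i) (∏ᶜ fun s : Γ.S => supp s.1) ≫
    Pi.π (fun s : Γ.S => supp s.1) ⟨s, hs⟩

/-- The regular epimorphism from an object to its support. -/
noncomputable def toSupp (r : R) : r ⟶ supp r := factorThruImage (toUnit r)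

instance (r : R) : IsRegularEpi (toSupp r) :=
  inferInstanceAs (IsRegularEpi (factorThruImage (toUnit r)))

theorem interp_map_proj {Γ Δ : Ctx R} (f : Γ ⟶ Δ) (i : Fin Δ.n) :
    R.interp.map f ≫ proj Δ i = proj Γ (f.fn i) ≫ eqToHom (f.comm i) := by
  have : Finite Γ.S := Γ.finite_S
  have : Finite Δ.S := Δ.finite_S
  dsimp only [proj, interp]
  rw [tensorHom_fst_assoc, Pi.lift_π, Category.assoc]

/-- The support factors carry a condition but no data, since maps into a support are unique. -/
theorem interp_hom_ext {Γ : Ctx R} {W : R} {y z : W ⟶ R.interp.obj Γ}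
    (h : ∀ i, y ≫ proj Γ i = z ≫ proj Γ i) : y = z := by
  have : Finite Γ.S := Γ.finite_S
  refine CartesianMonoidalCategory.hom_ext _ _ (Pi.hom_ext _ _ fun i => ?_)
    (Pi.hom_ext _ _ fun s => supp_hom_ext _ _)
  exact (Category.assoc _ _ _).trans ((h i).trans (Category.assoc _ _ _).symm)

theorem exists_point {Γ : Ctx R} {W : R} (x : ∀ i, W ⟶ Γ.τ i)
    (hs : ∀ s ∈ Γ.S, Nonempty (W ⟶ supp s)) :
    ∃ z : W ⟶ R.interp.obj Γ, ∀ i, z ≫ proj Γ i = x i := by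
  have : Finite Γ.S := Γ.finite_S
  refine ⟨lift (Pi.lift x) (Pi.lift fun s : Γ.S => (hs s.1 s.2).some), fun i => ?_⟩
  exact (Category.assoc _ _ _).symm.trans
    ((congrArg (· ≫ Pi.π _ i) (lift_fst _ _)).trans (Pi.lift_π _ _))

/-- The family of components of a generalised element of `⌜Γ⌝`. -/
noncomputable def tuple {Γ : Ctx R} {W : R} (z : W ⟶ R.interp.obj Γ) (i : Fin Γ.n) :
    Σ r : R, (W ⟶ r) :=
  ⟨Γ.τ i, z ≫ proj Γ i⟩

theorem sigma_comp_eqToHom {W r r' : R} (h : r = r') (a : W ⟶ r) :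
    (⟨r', a ≫ eqToHom h⟩ : Σ r : R, (W ⟶ r)) = ⟨r, a⟩ := by
  subst h; simp

/-- Keeping each component together with its type makes reindexing an equality free of the
transports in `interp_map_proj`. -/
theorem tuple_map {Γ Δ : Ctx R} (f : Γ ⟶ Δ) {W : R} (z : W ⟶ R.interp.obj Γ) (i : Fin Δ.n) :
    tuple (z ≫ R.interp.map f) i = tuple z (f.fn i) := by
  unfold tuple
  rw [Category.assoc, interp_map_proj, ← Category.assoc, sigma_comp_eqToHom]

theorem tuple_ext {Γ : Ctx R} {W : R} {y z : W ⟶ R.interp.obj Γ}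
    (h : ∀ i, tuple y i = tuple z i) : y = z :=
  interp_hom_ext fun i => eq_of_heq (Sigma.mk.inj (h i)).2

theorem exists_tuple {Γ : Ctx R} {W : R} (x : Fin Γ.n → Σ r : R, (W ⟶ r))
    (hx : ∀ i, (x i).1 = Γ.τ i) (hs : ∀ s ∈ Γ.S, Nonempty (W ⟶ supp s)) :
    ∃ z : W ⟶ R.interp.obj Γ, ∀ i, tuple z i = x i := by
  obtain ⟨z, hz⟩ := exists_point (Γ := Γ) (fun i => (x i).2 ≫ eqToHom (hx i)) hs
  refine ⟨z, fun i => ?_⟩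
  unfold tuple
  rw [hz, sigma_comp_eqToHom]

theorem nonempty_supp {Γ : Ctx R} {W : R} (z : W ⟶ R.interp.obj Γ) {s : R} (hs : s ∈ Γ.S) :
    Nonempty (W ⟶ supp s) :=
  ⟨z ≫ projSupp Γ s hs⟩

/-- Finitely many objects whose supports are inhabited at a stage are inhabited on a cover. -/
theorem locally_inhabited {W : R} : ∀ {n : ℕ} (r : Fin n → R),
    (∀ i, Nonempty (W ⟶ supp (r i))) →
      Locally (W := W) (fun {W'} _ => ∀ i, Nonempty (W' ⟶ r i))
  | 0, _, _ => Locally.of_id fun i => i.elim0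
  | n + 1, r, h => by
    refine (locally_inhabited (fun i : Fin n => r i.succ) fun i => h i.succ).trans ?_
    intro W' e h'
    refine (Locally.lift (toSupp (r 0)) inferInstance (e ≫ (h 0).some)).mono ?_
    rintro W'' e' ⟨y, -⟩
    exact Fin.cases ⟨y⟩ fun i => (h' i).map (e' ≫ ·)

/-- Here the support factors are essential. The variables of `Γ` outside the range of `f.fn` have
types in the common support, so these types are inhabited on a cover and an element of `⌜Δ⌝` extends
to one of `⌜Γ⌝` there. -/
theorem isRegularEpi_interp_map {Γ Δ : Ctx R} (f : Γ ⟶ Δ) (hf : IsRegularEpi f) :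
    IsRegularEpi (R.interp.map f) := by
  classical
  obtain ⟨hinj, hS⟩ := (Ctx.isRegularEpi_iff f).1 hf
  refine isRegularEpi_of_locally _ ?_
  refine (locally_inhabited (W := R.interp.obj Δ) Γ.τ fun i =>
    nonempty_supp (𝟙 _) (hS ▸ Γ.τ_mem i)).mono ?_
  intro W' e h
  obtain ⟨y, hy⟩ := exists_tuple (Γ := Γ) (W := W')
    -- In the range of `f.fn` the value is forced by `e`; elsewhere any local inhabitant serves.
    -- Injectivity of `f.fn` makes the forced value independent of the chosen preimage.
    (fun i => if hi : ∃ j, f.fn j = i then tuple e hi.choose else ⟨Γ.τ i, (h i).some⟩)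
    (fun i => by
      split_ifs with hi
      · exact (f.comm _).symm.trans (congrArg Γ.τ hi.choose_spec)
      · rfl)
    (fun s hs => nonempty_supp e (hS ▸ hs))
  refine ⟨y, tuple_ext fun j => ?_⟩
  rw [tuple_map, hy]
  have hj : ∃ j', f.fn j' = f.fn j := ⟨j, rfl⟩
  rw [dif_pos hj]
  exact congrArg _ (hinj hj.choose_spec)

/-- The interpretation weakly preserves pullbacks: two generalised elements of contexts at the same
stage factor through a common context. -/
theorem interp_exists_pullback {X Y Z : Ctx R} (f : X ⟶ Z) (g : Y ⟶ Z) {W : R}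
    (p : W ⟶ R.interp.obj X) (q : W ⟶ R.interp.obj Y)
    (h : p ≫ R.interp.map f = q ≫ R.interp.map g) :
    ∃ r : W ⟶ R.interp.obj (pullback f g), r ≫ R.interp.map (pullback.fst f g) = p ∧
      r ≫ R.interp.map (pullback.snd f g) = q := by
  -- The variables of the common context are the distinct typed values of `p` and `q`. Equal values
  -- become the same variable, which is what makes the two context morphisms below agree over `Z`.
  let A : Set (Σ r : R, (W ⟶ r)) := Set.range (tuple p) ∪ Set.range (tuple q)
  have hA : A.Finite := (Set.finite_range _).union (Set.finite_range _)
  have : Finite A := hA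
  obtain ⟨m, ⟨e⟩⟩ := Finite.exists_equiv_fin A
  let Q : Ctx R :=
    { n := m
      S := X.S ∪ Y.S
      finite_S := X.finite_S.union Y.finite_S
      τ := fun i => (e.symm i).1.1
      τ_mem := fun i => by
        obtain ⟨j, hj⟩ | ⟨j, hj⟩ := (e.symm i).2
        · rw [← hj]; exact Or.inl (X.τ_mem j)
        · rw [← hj]; exact Or.inr (Y.τ_mem j) }
  let a : Q ⟶ X := ⟨fun i => e ⟨tuple p i, Or.inl ⟨i, rfl⟩⟩, Set.subset_union_left,
    fun i => by simp [Q, tuple]⟩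
  let b : Q ⟶ Y := ⟨fun i => e ⟨tuple q i, Or.inr ⟨i, rfl⟩⟩, Set.subset_union_right,
    fun i => by simp [Q, tuple]⟩
  have hab : a ≫ f = b ≫ g := Ctx.hom_ext fun i => by
    refine congrArg e (Subtype.ext ?_)
    change tuple p (f.fn i) = tuple q (g.fn i)
    rw [← tuple_map, ← tuple_map, h]
  obtain ⟨w, hw⟩ := exists_tuple (Γ := Q) (W := W) (fun i => (e.symm i).1) (fun i => rfl) (by
    rintro s (hs | hs)
    · exact nonempty_supp p hs
    · exact nonempty_supp q hs)
  refine ⟨w ≫ R.interp.map (pullback.lift a b hab), ?_, ?_⟩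
  · rw [Category.assoc, ← Functor.map_comp, pullback.lift_fst]
    refine tuple_ext fun i => ?_
    rw [tuple_map, hw]
    simp [a]
  · rw [Category.assoc, ← Functor.map_comp, pullback.lift_snd]
    refine tuple_ext fun i => ?_
    rw [tuple_map, hw]
    simp [b]

/-- The composite with `Ctx.map t` is what the target of a morphism of calculi requires; `t = id`
gives the interpretation itself. -/
theorem preservesPairs_map_interp {T : Type u} (t : T → R) :
    PreservesPairs (Ctx.map t ⋙ R.interp) where
  exists_pair {Γ Δ W} p q := by
    obtain ⟨r, hr⟩ := exists_tuple (Γ := (Ctx.map t).obj (Γ ⊗ Δ)) (W := W)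
      (Fin.append (tuple p) (tuple q))
      (fun i => by
        refine Fin.addCases (fun i => ?_) (fun i => ?_) i
        · refine (congrArg Sigma.fst (Fin.append_left (tuple p) (tuple q) i)).trans ?_
          exact (congrArg t (Fin.append_left Γ.τ Δ.τ i)).symm
        · refine (congrArg Sigma.fst (Fin.append_right (tuple p) (tuple q) i)).trans ?_
          exact (congrArg t (Fin.append_right Γ.τ Δ.τ i)).symm)
      (by
        rintro _ ⟨s, hs | hs, rfl⟩
        · exact nonempty_supp p ⟨s, hs, rfl⟩
        · exact nonempty_supp q ⟨s, hs, rfl⟩)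
    refine ⟨r, tuple_ext fun i => ?_, tuple_ext fun i => ?_⟩
    · exact ((tuple_map ((Ctx.map t).map (fst Γ Δ)) r i).trans (hr _)).trans (Fin.append_left _ _ i)
    · exact ((tuple_map ((Ctx.map t).map (snd Γ Δ)) r i).trans (hr _)).trans
        (Fin.append_right _ _ i)
  pair_ext {Γ Δ W p q} h₁ h₂ := by
    refine tuple_ext fun i => ?_
    refine Fin.addCases (fun i => ?_) (fun i => ?_) i
    · have := congrArg (fun z => tuple z i) h₁
      exact ((tuple_map ((Ctx.map t).map (fst Γ Δ)) p i).symm.trans this).trans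
        (tuple_map ((Ctx.map t).map (fst Γ Δ)) q i)
    · have := congrArg (fun z => tuple z i) h₂
      exact ((tuple_map ((Ctx.map t).map (snd Γ Δ)) p i).symm.trans this).trans
        (tuple_map ((Ctx.map t).map (snd Γ Δ)) q i)
  exists_unit W := by
    obtain ⟨z, -⟩ := exists_tuple (Γ := (Ctx.map t).obj (𝟙_ (Ctx T))) (W := W) Fin.elim0
      (fun i => i.elim0) (by rintro _ ⟨s, hs, -⟩; exact hs.elim)
    exact ⟨z⟩
  unit_ext p q := tuple_ext fun i => i.elim0

theorem preservesPairs_interp (R : RgCat.{v, u}) : PreservesPairs R.interp := by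
  have h := preservesPairs_map_interp (R := R) (id : R → R)
  rwa [Ctx.map_id, Functor.id_comp] at h

theorem preservesRel_interp (R : RgCat.{v, u}) : PreservesRel R.interp where
  toPreservesPairs := preservesPairs_interp R
  map_isRegularEpi := isRegularEpi_interp_map
  exists_pullback := interp_exists_pullback

/-- The regular calculus of subobjects of a regular category. -/
noncomputable def prdObj (R : RgCat.{v, u}) : RgCalc.{max u v, u} where
  toCalcData := R.prdData
  isAjax := SubLax.isAjax (preservesRel_interp R)

end Points

end RgCat

/-! ### The direct image of subobjects along a regular functor -/

section MapSubobject

variable {D : Type*} [Category* D] [Regular D] {D' : Type*} [Category* D'] [Regular D']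
  (F : D ⥤ D') [PreservesFiniteLimits F]

/-- The subobject `F(φ) ⊆ F(X)`. -/
noncomputable def mapSubobject {X : D} (φ : Subobject X) : Subobject (F.obj X) :=
  Subobject.mk (F.map φ.arrow)

theorem factors_mapSubobject_iff {X : D} (φ : Subobject X) {W : D'} (w : W ⟶ F.obj X) :
    (mapSubobject F φ).Factors w ↔ ∃ y : W ⟶ F.obj (φ : D), y ≫ F.map φ.arrow = w :=
  Iff.rfl

theorem factors_mapSubobject_map {X Y : D} {φ : Subobject X} {y : Y ⟶ X} (h : φ.Factors y)
    {W : D'} (w : W ⟶ F.obj Y) : (mapSubobject F φ).Factors (w ≫ F.map y) :=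
  (factors_mapSubobject_iff F φ _).2 ⟨w ≫ F.map (φ.factorThru y h), by
    rw [Category.assoc, ← F.map_comp, Subobject.factorThru_arrow]⟩

theorem mapSubobject_top {X : D} : mapSubobject F (⊤ : Subobject X) = ⊤ :=
  Subobject.ext_factors fun W w => by
    have := factors_mapSubobject_map F (Subobject.top_factors (𝟙 X)) w
    simpa [Subobject.top_factors] using this

theorem mapSubobject_pullback {X Y : D} (f : X ⟶ Y) (φ : Subobject Y) :
    mapSubobject F ((Subobject.pullback f).obj φ) =
      (Subobject.pullback (F.map f)).obj (mapSubobject F φ) := by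
  refine Subobject.ext_factors fun W w => ?_
  rw [Subobject.factors_pullback_iff, factors_mapSubobject_iff, factors_mapSubobject_iff]
  have sq := (Subobject.isPullback f φ).map F
  constructor
  · rintro ⟨y, rfl⟩
    exact ⟨y ≫ F.map (Subobject.pullbackπ f φ), by rw [Category.assoc, Category.assoc, sq.w]⟩
  · rintro ⟨y, hy⟩
    exact ⟨sq.lift y w hy, sq.lift_snd _ _ _⟩

theorem mapSubobject_inf {X : D} (φ ψ : Subobject X) :
    mapSubobject F (φ ⊓ ψ) = mapSubobject F φ ⊓ mapSubobject F ψ := by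
  refine Subobject.ext_factors fun W w => ?_
  rw [Subobject.inf_factors, factors_mapSubobject_iff, factors_mapSubobject_iff,
    factors_mapSubobject_iff]
  constructor
  · rintro ⟨y, rfl⟩
    exact ⟨factors_mapSubobject_map F (Subobject.inf_arrow_factors_left φ ψ) y,
      factors_mapSubobject_map F (Subobject.inf_arrow_factors_right φ ψ) y⟩
  · rintro ⟨⟨y, hy⟩, ⟨y', hy'⟩⟩
    have sq := (Subobject.inf_isPullback φ ψ).map F
    refine ⟨sq.lift y y' (hy.trans hy'.symm), ?_⟩
    rw [← Subobject.inf_comp_left, F.map_comp, sq.lift_fst_assoc, hy]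

/-- `F` preserves the factorisation of `φ ⟶ Y` into a regular epimorphism and a monomorphism, so it
carries the image to the image. -/
theorem mapSubobject_exists
    (hF : ∀ {X Y : D} (f : X ⟶ Y), IsRegularEpi f → IsRegularEpi (F.map f))
    {X Y : D} (f : X ⟶ Y) (φ : Subobject X) :
    mapSubobject F ((Subobject.exists f).obj φ) =
      (Subobject.exists (F.map f)).obj (mapSubobject F φ) := by
  have hθ := Subobject.exists_eq_imageSubobject f φ
  let θ := imageSubobject (φ.arrow ≫ f)
  let g : (φ : D) ⟶ (θ : D) := factorThruImageSubobject (φ.arrow ≫ f)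
  have hg : g ≫ θ.arrow = φ.arrow ≫ f := imageSubobject_arrow_comp _
  have hFg := hF g (isRegularEpi_factorThruImageSubobject _)
  rw [hθ]
  refine Subobject.ext_factors fun W w => ?_
  rw [Subobject.factors_exists_iff, factors_mapSubobject_iff]
  constructor
  · rintro ⟨y, rfl⟩
    refine (Locally.lift _ hFg y).mono ?_
    rintro W' e ⟨v, hv⟩
    refine ⟨v ≫ F.map φ.arrow, ⟨v, rfl⟩, ?_⟩
    rw [← reassoc_of% hv, Category.assoc, ← F.map_comp, ← F.map_comp]
    exact congrArg (fun k => v ≫ F.map k) hg.symm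
  · rintro ⟨W', e, he, y', hy', hy⟩
    rw [factors_mapSubobject_iff] at hy'
    obtain ⟨y, rfl⟩ := hy'
    refine exists_lift_of_cover _ e ⟨y ≫ F.map g, ?_⟩
    rw [← hy, Category.assoc, Category.assoc, ← F.map_comp, ← F.map_comp]
    exact congrArg (fun k => y ≫ F.map k) hg

end MapSubobject

/-! ### Transport of subobjects along a regular functor and a natural isomorphism -/

namespace SubLax

variable {D : Type u} [Category.{v} D] [CartesianMonoidalCategory D] [Regular D]
  {D' : Type u} [Category.{v} D'] [CartesianMonoidalCategory D'] [Regular D']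
  {C : Type*} [Category* C] [CartesianMonoidalCategory C] [Regular C]
  {C' : Type*} [Category* C'] [CartesianMonoidalCategory C'] [Regular C']
  {J : C ⥤ D} {J' : C' ⥤ D'} {H : C ⥤ C'} {F : D ⥤ D'}

theorem act_eq {X Y : C} (x : RelHom X Y) (φ : Subobject (J.obj X)) :
    act J x φ = (Subobject.exists (J.map x.tgt)).obj ((Subobject.pullback (J.map x.src)).obj φ) := by
  refine Subobject.ext_factors fun W z => ?_
  simp only [factors_act_iff, Subobject.factors_exists_iff, Subobject.factors_pullback_iff]

theorem act_ofSpan_eq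
    (hJ : ∀ {X Y : C} (f : X ⟶ Y), IsRegularEpi f → IsRegularEpi (J.map f)) {X Y A : C}
    (f : A ⟶ X) (g : A ⟶ Y) (φ : Subobject (J.obj X)) :
    act J (RelHom.ofSpan f g) φ =
      (Subobject.exists (J.map g)).obj ((Subobject.pullback (J.map f)).obj φ) := by
  refine Subobject.ext_factors fun W z => ?_
  simp only [factors_act_ofSpan_iff hJ, Subobject.factors_exists_iff,
    Subobject.factors_pullback_iff]

variable [PreservesFiniteLimits F] (κ : J ⋙ F ≅ H ⋙ J')

/-- The action of `F` on subobjects of `J X`, transported along `κ : F (J X) ≅ J' (H X)`. -/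
noncomputable def mapApp (κ : J ⋙ F ≅ H ⋙ J') {X : C} (φ : Subobject (J.obj X)) :
    Subobject (J'.obj (H.obj X)) :=
  imageSubobject (F.map φ.arrow ≫ κ.hom.app X)

/-- Since `κ` is invertible, the image along it is the pullback along its inverse; membership then
needs no passage to a cover. -/
theorem mapApp_eq_pullback {X : C} (φ : Subobject (J.obj X)) :
    mapApp κ φ = (Subobject.pullback (κ.inv.app X)).obj (mapSubobject F φ) := by
  refine Subobject.ext_factors fun W z => ?_
  unfold mapApp
  have h : κ.hom.app X ≫ κ.inv.app X = 𝟙 (F.obj (J.obj X)) := κ.hom_inv_id_app X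
  have h' : κ.inv.app X ≫ κ.hom.app X = 𝟙 (J'.obj (H.obj X)) := κ.inv_hom_id_app X
  rw [Subobject.factors_imageSubobject_iff, Subobject.factors_pullback_iff,
    factors_mapSubobject_iff]
  constructor
  · rintro ⟨W', e, he, y, hy⟩
    refine exists_lift_of_cover _ e ⟨y, ?_⟩
    rw [← reassoc_of% hy]
    exact ((congrArg (fun k => y ≫ F.map φ.arrow ≫ k) h).trans
      (congrArg (y ≫ ·) (Category.comp_id _))).symm
  · rintro ⟨y, hy⟩
    refine Locally.of_id ⟨y, ?_⟩
    rw [reassoc_of% hy, Category.id_comp]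
    exact (congrArg (z ≫ ·) h').trans (Category.comp_id _)

theorem factors_mapApp_iff {X : C} (φ : Subobject (J.obj X)) {W : D'}
    (z : W ⟶ J'.obj (H.obj X)) :
    (mapApp κ φ).Factors z ↔ (mapSubobject F φ).Factors (z ≫ κ.inv.app X) := by
  rw [mapApp_eq_pullback]
  exact Subobject.factors_pullback_iff _

theorem mapApp_top {X : C} : mapApp κ (⊤ : Subobject (J.obj X)) = ⊤ := by
  refine Subobject.ext_factors fun W z => ?_
  rw [factors_mapApp_iff, mapSubobject_top]
  exact iff_of_true (Subobject.top_factors _) (Subobject.top_factors _)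

theorem inv_naturality {X Y : C} (f : X ⟶ Y) :
    J'.map (H.map f) ≫ κ.inv.app Y = κ.inv.app X ≫ F.map (J.map f) :=
  κ.inv.naturality f

theorem factors_mapApp_comp_iff {X Y : C} (f : X ⟶ Y) (φ : Subobject (J.obj Y)) {W : D'}
    (z : W ⟶ J'.obj (H.obj X)) :
    (mapApp κ φ).Factors (z ≫ J'.map (H.map f)) ↔
      (mapSubobject F φ).Factors ((z ≫ κ.inv.app X) ≫ F.map (J.map f)) := by
  rw [factors_mapApp_iff, Category.assoc, Category.assoc, inv_naturality κ f]

theorem mapApp_pullback {X Y : C} (f : X ⟶ Y) (φ : Subobject (J.obj Y)) :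
    mapApp κ ((Subobject.pullback (J.map f)).obj φ) =
      (Subobject.pullback (J'.map (H.map f))).obj (mapApp κ φ) := by
  refine Subobject.ext_factors fun W z => ?_
  rw [factors_mapApp_iff, mapSubobject_pullback]
  refine (Subobject.factors_pullback_iff (F.map (J.map f))).trans ?_
  rw [Subobject.factors_pullback_iff]
  exact (factors_mapApp_comp_iff κ f φ z).symm

theorem mapApp_inf {X : C} (φ ψ : Subobject (J.obj X)) :
    mapApp κ (φ ⊓ ψ) = mapApp κ φ ⊓ mapApp κ ψ := by
  refine Subobject.ext_factors fun W z => ?_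
  rw [Subobject.inf_factors, factors_mapApp_iff, factors_mapApp_iff, factors_mapApp_iff,
    mapSubobject_inf]
  exact Subobject.inf_factors _

theorem mapApp_exists
    (hF : ∀ {X Y : D} (f : X ⟶ Y), IsRegularEpi f → IsRegularEpi (F.map f))
    {X Y : C} (f : X ⟶ Y) (φ : Subobject (J.obj X)) :
    mapApp κ ((Subobject.exists (J.map f)).obj φ) =
      (Subobject.exists (J'.map (H.map f))).obj (mapApp κ φ) := by
  refine Subobject.ext_factors fun W z => ?_
  rw [factors_mapApp_iff, mapSubobject_exists F hF]
  refine (Subobject.factors_exists_iff (F.map (J.map f))).trans ?_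
  rw [Subobject.factors_exists_iff]
  have hκ : ∀ X, κ.inv.app X ≫ κ.hom.app X = 𝟙 (J'.obj (H.obj X)) :=
    fun X => κ.inv_hom_id_app X
  have hκ' : ∀ X, κ.hom.app X ≫ κ.inv.app X = 𝟙 (F.obj (J.obj X)) :=
    fun X => κ.hom_inv_id_app X
  have nat : F.map (J.map f) ≫ κ.hom.app Y = κ.hom.app X ≫ J'.map (H.map f) :=
    κ.hom.naturality f
  constructor <;> refine fun h => h.mono ?_
  · rintro W' e ⟨y, hy, hy'⟩
    refine ⟨y ≫ κ.hom.app X, ?_, ?_⟩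
    · rw [factors_mapApp_iff, Category.assoc]
      refine Eq.mp (congrArg (mapSubobject F φ).Factors ?_) hy
      exact ((congrArg (y ≫ ·) (hκ' X)).trans (Category.comp_id _)).symm
    · rw [Category.assoc]
      refine (congrArg (y ≫ ·) nat.symm).trans ?_
      refine (Category.assoc _ _ _).symm.trans ((congrArg (· ≫ κ.hom.app Y) hy').trans ?_)
      rw [Category.assoc, Category.assoc]
      exact congrArg (e ≫ ·) ((congrArg (z ≫ ·) (hκ Y)).trans (Category.comp_id _))
  · rintro W' e ⟨y, hy, hy'⟩
    rw [factors_mapApp_iff] at hy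
    refine ⟨y ≫ κ.inv.app X, hy, ?_⟩
    rw [← reassoc_of% hy', inv_naturality κ f]
    exact Category.assoc _ _ _

theorem mapApp_act (hJ' : ∀ {X Y : C'} (f : X ⟶ Y), IsRegularEpi f → IsRegularEpi (J'.map f))
    (hF : ∀ {X Y : D} (f : X ⟶ Y), IsRegularEpi f → IsRegularEpi (F.map f))
    {X Y : C} (x : RelHom X Y) (φ : Subobject (J.obj X)) :
    mapApp κ (act J x φ) = act J' (RelHom.map H x) (mapApp κ φ) := by
  unfold RelHom.map
  rw [act_eq, act_ofSpan_eq hJ', mapApp_exists κ hF, mapApp_pullback]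

theorem mapApp_prod {X Y : C} (φ : Subobject (J.obj X)) (ψ : Subobject (J.obj Y)) {W : D'}
    (z : W ⟶ J'.obj (H.obj (X ⊗ Y))) :
    (mapApp κ (prod J φ ψ)).Factors z ↔
      (mapApp κ φ).Factors (z ≫ J'.map (H.map (fst X Y))) ∧
        (mapApp κ ψ).Factors (z ≫ J'.map (H.map (snd X Y))) := by
  rw [prod_eq_inf, mapApp_inf, Subobject.inf_factors, mapApp_pullback, mapApp_pullback,
    Subobject.factors_pullback_iff, Subobject.factors_pullback_iff]

/-- A regular functor acts on subobjects by a monoidal natural transformation. -/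
theorem isMonoidalNat_mapApp (hJ' : PreservesRel J') (hHJ' : PreservesPairs (H ⋙ J'))
    (hF : ∀ {X Y : D} (f : X ⟶ Y), IsRegularEpi f → IsRegularEpi (F.map f))
    (a : ∀ X, (subLax J).obj X →o (subLax J').obj (H.obj X))
    (ha : ∀ X (φ : Subobject (J.obj X)), a X φ = mapApp κ φ) :
    (subLax J).IsMonoidalNat H (subLax J') a where
  natural x φ := (ha _ _).trans ((mapApp_act κ hJ'.map_isRegularEpi hF x φ).trans
    (congrArg ((subLax J').map (RelHom.map H x)) (ha _ φ).symm))
  unit := by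
    refine Eq.trans (congrArg _ (ha _ _)) ?_
    refine (act_graph hJ'.map_isRegularEpi _ _).trans ?_
    refine Subobject.ext_factors fun W z => iff_of_true ?_ (Subobject.top_factors _)
    rw [Subobject.factors_exists_iff]
    -- Any element of `J' (H 1)` is a preimage of `z`, because elements of `J' 1` at a given stage
    -- coincide.
    obtain ⟨y⟩ := hHJ'.exists_unit W
    refine Locally.of_id ⟨y, ?_, hJ'.unit_ext _ _⟩
    have := mapApp_top κ (X := 𝟙_ C)
    exact this ▸ Subobject.top_factors y
  lax {X Y} φ ψ := by
    refine Eq.trans (congrArg _ (ha _ _)) ?_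
    refine Eq.trans (b := prod J' (mapApp κ φ) (mapApp κ ψ)) ?_
      (congrArg₂ (fun φ ψ => prod J' φ ψ) (ha _ φ).symm (ha _ ψ).symm)
    refine (act_graph hJ'.map_isRegularEpi _ _).trans ?_
    refine Subobject.ext_factors fun W z => ?_
    rw [Subobject.factors_exists_iff, factors_prod_iff]
    have h₁ : J'.map (CartesianMonoidalCategory.prodComparison H X Y) ≫ J'.map (fst _ _) =
        J'.map (H.map (fst X Y)) := by
      rw [← J'.map_comp, CartesianMonoidalCategory.prodComparison_fst]
    have h₂ : J'.map (CartesianMonoidalCategory.prodComparison H X Y) ≫ J'.map (snd _ _) =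
        J'.map (H.map (snd X Y)) := by
      rw [← J'.map_comp, CartesianMonoidalCategory.prodComparison_snd]
    constructor
    · rintro ⟨W', e, he, y, hy, hy'⟩
      obtain ⟨hy₁, hy₂⟩ := (mapApp_prod κ φ ψ y).1 hy
      rw [← Subobject.factors_cover_iff e, ← Subobject.factors_cover_iff (φ := mapApp κ ψ) e,
        ← reassoc_of% hy', ← reassoc_of% hy', h₁, h₂]
      exact ⟨hy₁, hy₂⟩
    · rintro ⟨hz₁, hz₂⟩
      -- The components of `z` are paired inside `J' (H (X ⊗ Y))`, so `z` lifts through the product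
      -- comparison without a cover.
      obtain ⟨y, hy₁, hy₂⟩ := hHJ'.exists_pair (z ≫ J'.map (fst _ _)) (z ≫ J'.map (snd _ _))
      refine Locally.of_id ⟨y, (mapApp_prod κ φ ψ y).2 ⟨?_, ?_⟩, hJ'.pair_ext ?_ ?_⟩
      · exact Eq.mp (congrArg (mapApp κ φ).Factors hy₁.symm) hz₁
      · exact Eq.mp (congrArg (mapApp κ ψ).Factors hy₂.symm) hz₂
      · rw [Category.assoc, h₁, Category.id_comp]; exact hy₁
      · rw [Category.assoc, h₂, Category.id_comp]; exact hy₂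

end SubLax

/-! ### Images of composites -/

section Image

variable {C : Type*} [Category* C] [Regular C]

theorem imageSubobject_precomp {A B X : C} (e : A ⟶ B) (he : IsRegularEpi e) (f : B ⟶ X) :
    imageSubobject (e ≫ f) = imageSubobject f := by
  refine Subobject.ext_factors fun W z => ?_
  rw [Subobject.factors_imageSubobject_iff, Subobject.factors_imageSubobject_iff]
  constructor
  · refine fun h => h.mono ?_
    rintro W' d ⟨y, hy⟩
    exact ⟨y ≫ e, by rw [Category.assoc, hy]⟩
  · refine fun h => h.trans ?_
    rintro W' d ⟨y, hy⟩
    refine (Locally.lift e he y).mono ?_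
    rintro W'' d' ⟨x, hx⟩
    exact ⟨x, by rw [reassoc_of% hx, hy, Category.assoc]⟩

theorem imageSubobject_map_arrow {D : Type*} [Category* D] [Regular D] (F : D ⥤ C)
    (hF : ∀ {X Y : D} (f : X ⟶ Y), IsRegularEpi f → IsRegularEpi (F.map f)) {A X : D} {Y : C}
    (f : A ⟶ X) (g : F.obj X ⟶ Y) :
    imageSubobject (F.map (imageSubobject f).arrow ≫ g) = imageSubobject (F.map f ≫ g) := by
  rw [← imageSubobject_precomp _ (hF _ (isRegularEpi_factorThruImageSubobject f)),
    ← Category.assoc, ← F.map_comp]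
  simp only [imageSubobject_arrow_comp]

theorem imageSubobject_arrow_image {A X Y : C} (f : A ⟶ X) (g : X ⟶ Y) :
    imageSubobject ((imageSubobject f).arrow ≫ g) = imageSubobject (f ≫ g) :=
  imageSubobject_map_arrow (𝟭 C) (fun _ h => h) f g

end Image

/-! ### The comparison isomorphism and functoriality -/

namespace RgCat

variable {R R' R'' : RgCat.{v, u}}

section Comparison

variable (F : R ⟶ R')

instance : PreservesFiniteLimits (toFunctor F) := F.preservesFiniteLimits

theorem toFunctor_map_isRegularEpi {X Y : R} (f : X ⟶ Y) (hf : IsRegularEpi f) :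
    IsRegularEpi ((toFunctor F).map f) :=
  F.map_isRegularEpi f hf

theorem interpComparison_proj (Γ : Ctx R) (i : Fin Γ.n) :
    interpComparison F Γ ≫ proj ((Ctx.map (toFunctor F).obj).obj Γ) i =
      (toFunctor F).map (proj Γ i) :=
  (Category.assoc _ _ _).symm.trans
    ((congrArg (· ≫ Pi.π _ i) (lift_fst _ _)).trans (Pi.lift_π _ _))

/-- `F` preserves monomorphisms and the terminal object, so `F(Supp r)` is again a subobject of a
terminal object. -/
theorem map_supp_hom_ext {W : R'} {r : R} (f g : W ⟶ (toFunctor F).obj (supp r)) : f = g := by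
  have h : IsTerminal ((toFunctor F).obj (𝟙_ R)) :=
    IsTerminal.isTerminalObj (toFunctor F) _ isTerminalTensorUnit
  have : Mono ((toFunctor F).map (image.ι (toUnit r))) := inferInstance
  exact (cancel_mono ((toFunctor F).map (image.ι (toUnit r)))).1 (h.hom_ext _ _)

theorem map_interp_hom_ext {Γ : Ctx R} {W : R'} {y z : W ⟶ (toFunctor F).obj (R.interp.obj Γ)}
    (h : ∀ i, y ≫ (toFunctor F).map (proj Γ i) = z ≫ (toFunctor F).map (proj Γ i)) : y = z := by
  have : Finite Γ.S := Γ.finite_S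
  let a := ∏ᶜ fun i : Fin Γ.n => Γ.τ i
  let b := ∏ᶜ fun s : Γ.S => supp s.1
  -- The statement is phrased for the explicit product `a ⊗ b`, so that the invertible product
  -- comparisons of `F` apply.
  have key : ∀ y z : W ⟶ (toFunctor F).obj (a ⊗ b),
      (∀ i, y ≫ (toFunctor F).map (fst a b ≫ Pi.π _ i) =
        z ≫ (toFunctor F).map (fst a b ≫ Pi.π _ i)) → y = z := by
    intro y z h
    rw [← cancel_mono (CartesianMonoidalCategory.prodComparison (toFunctor F) a b)]
    apply CartesianMonoidalCategory.hom_ext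
    · rw [Category.assoc, Category.assoc, CartesianMonoidalCategory.prodComparison_fst,
        ← cancel_mono (piComparison (toFunctor F) fun i : Fin Γ.n => Γ.τ i)]
      refine Pi.hom_ext _ _ fun i => ?_
      simpa [a] using h i
    · rw [Category.assoc, Category.assoc, CartesianMonoidalCategory.prodComparison_snd,
        ← cancel_mono (piComparison (toFunctor F) fun s : Γ.S => supp s.1)]
      exact Pi.hom_ext _ _ fun s => map_supp_hom_ext F _ _
  exact key y z h

theorem exists_map_point {Γ : Ctx R} {W : R'} (x : ∀ i, W ⟶ (toFunctor F).obj (Γ.τ i))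
    (hs : ∀ s ∈ Γ.S, Nonempty (W ⟶ (toFunctor F).obj (supp s))) :
    ∃ z : W ⟶ (toFunctor F).obj (R.interp.obj Γ),
      ∀ i, z ≫ (toFunctor F).map (proj Γ i) = x i := by
  have : Finite Γ.S := Γ.finite_S
  let a := ∏ᶜ fun i : Fin Γ.n => Γ.τ i
  let b := ∏ᶜ fun s : Γ.S => supp s.1
  have key : ∃ z : W ⟶ (toFunctor F).obj (a ⊗ b),
      ∀ i, z ≫ (toFunctor F).map (fst a b ≫ Pi.π _ i) = x i := by
    refine ⟨lift (Pi.lift x ≫ inv (piComparison (toFunctor F) _))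
      (Pi.lift (fun s : Γ.S => (hs s.1 s.2).some) ≫ inv (piComparison (toFunctor F) _)) ≫
      inv (CartesianMonoidalCategory.prodComparison (toFunctor F) a b), fun i => ?_⟩
    have h₁ : inv (CartesianMonoidalCategory.prodComparison (toFunctor F) a b) ≫
        (toFunctor F).map (fst a b) = fst _ _ := by
      rw [IsIso.inv_comp_eq, CartesianMonoidalCategory.prodComparison_fst]
    have h₂ : inv (piComparison (toFunctor F) fun i : Fin Γ.n => Γ.τ i) ≫
        (toFunctor F).map (Pi.π _ i) = Pi.π _ i := by
      rw [IsIso.inv_comp_eq, piComparison_comp_π]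
    rw [Functor.map_comp, Category.assoc, reassoc_of% h₁, lift_fst_assoc, Category.assoc, h₂,
      Pi.lift_π]
  exact key

/-- The map `Supp(F r) ⟶ F(Supp r)`. -/
noncomputable def suppComparisonInv (r : R) :
    supp ((toFunctor F).obj r) ⟶ (toFunctor F).obj (supp r) :=
  have : Mono (toUnit ((toFunctor F).obj (supp r))) :=
    ⟨fun _ _ _ => map_supp_hom_ext F _ _⟩
  -- `F(r) ⟶ F(Supp r) ⟶ 1` has a monomorphism as second factor, and the image is the least such
  -- factorisation.
  image.lift
    { I := (toFunctor F).obj (supp r)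
      m := toUnit _
      e := (toFunctor F).map (toSupp r)
      fac := toUnit_unique _ _ }

/-- The inverse has the same components at the variables, and uses `Supp(F s) ⟶ F(Supp s)` at the
supports. Both composites are identities because elements on either side are determined by their
components at the variables. -/
instance (Γ : Ctx R) : IsIso (interpComparison F Γ) := by
  obtain ⟨k, hk⟩ := exists_map_point F (Γ := Γ)
    (W := R'.interp.obj ((Ctx.map (toFunctor F).obj).obj Γ))
    (fun i => proj ((Ctx.map (toFunctor F).obj).obj Γ) i)
    (fun s hs => ⟨projSupp ((Ctx.map (toFunctor F).obj).obj Γ) _ ⟨s, hs, rfl⟩ ≫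
      suppComparisonInv F s⟩)
  refine ⟨k, map_interp_hom_ext F fun i => ?_, interp_hom_ext fun i => ?_⟩
  · rw [Category.assoc, hk, Category.id_comp]
    exact interpComparison_proj F Γ i
  · exact (Category.assoc _ _ _).trans ((congrArg (k ≫ ·) (interpComparison_proj F Γ i)).trans
      ((hk i).trans (Category.id_comp _).symm))

/-- The comparison `F⌜Γ⌝ ≅ ⌜FRg(Ob F)(Γ)⌝` as a natural isomorphism. -/
noncomputable def interpIso :
    R.interp ⋙ toFunctor F ≅ Ctx.map (toFunctor F).obj ⋙ R'.interp :=
  NatIso.ofComponents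
    (fun Γ => asIso (C := R') (X := (toFunctor F).obj (R.interp.obj Γ)) (interpComparison F Γ))
    fun {Γ Δ} f => by
      refine interp_hom_ext (Γ := (Ctx.map (toFunctor F).obj).obj Δ) fun i => ?_
      change ((toFunctor F).map (R.interp.map f) ≫ interpComparison F Δ) ≫
          proj ((Ctx.map (toFunctor F).obj).obj Δ) i =
        (interpComparison F Γ ≫ R'.interp.map ((Ctx.map (toFunctor F).obj).map f)) ≫
          proj ((Ctx.map (toFunctor F).obj).obj Δ) i
      have h₁ := congrArg ((toFunctor F).map (R.interp.map f) ≫ ·) (interpComparison_proj F Δ i)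
      have h₂ := congrArg (interpComparison F Γ ≫ ·)
        (interp_map_proj ((Ctx.map (toFunctor F).obj).map f) i)
      have h₃ := congrArg (· ≫ eqToHom (congrArg (toFunctor F).obj (f.comm i)))
        (interpComparison_proj F Γ (f.fn i))
      have h₄ := congrArg (toFunctor F).map (interp_map_proj f i)
      rw [Functor.map_comp, Functor.map_comp, eqToHom_map] at h₄
      exact (Category.assoc _ _ _).trans (h₁.trans (h₄.trans (h₃.symm.trans
        ((Category.assoc _ _ _).trans (h₂.symm.trans (Category.assoc _ _ _).symm)))))

/-- The morphism of regular calculi induced by a regular functor. -/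
noncomputable def prdMap : prdObj R ⟶ prdObj R' :=
  RgCalc.Hom.mk (A := prdObj R) (B := prdObj R') (prdMapData F)
    (SubLax.isMonoidalNat_mapApp (interpIso F) (preservesRel_interp R')
      (preservesPairs_map_interp _) (toFunctor_map_isRegularEpi F) _ fun _ _ => rfl)

theorem tuple_interpComparison {Γ : Ctx R} {W : R'} (z : W ⟶ (toFunctor F).obj (R.interp.obj Γ))
    (i : Fin Γ.n) :
    tuple (z ≫ interpComparison F Γ) i =
      ⟨(toFunctor F).obj (Γ.τ i), z ≫ (toFunctor F).map (proj Γ i)⟩ := by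
  unfold tuple
  rw [Category.assoc, interpComparison_proj]
  rfl

end Comparison

/-- Identities and composites in `RgCalc` involve transport along equalities of contexts. Writing
the transport as an image along a morphism lets it be absorbed into the comparison maps. -/
theorem eqHom_eq {Γ Δ : Ctx R} (h : Γ = Δ) (φ : Subobject (R.interp.obj Γ)) :
    R.prdData.P.eqHom h φ = imageSubobject (φ.arrow ≫ R.interp.map (eqToHom h)) := by
  subst h
  have h : φ.arrow ≫ R.interp.map (eqToHom (Eq.refl Γ)) = φ.arrow :=
    (congrArg (φ.arrow ≫ ·) (R.interp.map_id Γ)).trans (Category.comp_id _)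
  refine Eq.trans ?_ (congrArg (fun z => imageSubobject z) h).symm
  rw [imageSubobject_mono, Subobject.mk_arrow]
  rfl

theorem tuple_map_eqToHom {Γ Δ : Ctx R} (h : Γ = Δ) {W : R} (z : W ⟶ R.interp.obj Γ)
    (i : Fin Γ.n) (j : Fin Δ.n) (hij : (i : ℕ) = j) :
    tuple (z ≫ R.interp.map (eqToHom h)) j = tuple z i := by
  rw [tuple_map]
  exact congrArg _ (Fin.ext ((Ctx.eqToHom_fn h j).trans hij.symm))

theorem interpComparison_id (Γ : Ctx R) :
    interpComparison (𝟙 R) Γ =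
      R.interp.map (eqToHom (congrArg (fun F => F.obj Γ) Ctx.map_id.symm)) := by
  refine tuple_ext fun i => ?_
  have h₁ := tuple_interpComparison (𝟙 R) (𝟙 (R.interp.obj Γ)) i
  have h₂ := tuple_map_eqToHom (congrArg (fun F => F.obj Γ) Ctx.map_id.symm)
    (𝟙 (R.interp.obj Γ)) i i rfl
  rw [Category.id_comp] at h₂
  refine Eq.trans ?_ h₂.symm
  refine Eq.trans ?_ (h₁.trans rfl)
  exact congrArg (fun z => tuple z i) (Category.id_comp _).symm

theorem interpComparison_comp (F : R ⟶ R') (G : R' ⟶ R'') (Γ : Ctx R) :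
    interpComparison (F ≫ G) Γ =
      ((toFunctor G).map (interpComparison F Γ) ≫ interpComparison G _) ≫
        R''.interp.map (eqToHom (congrArg (fun F => F.obj Γ)
          (Ctx.map_comp (toFunctor F).obj (toFunctor G).obj).symm)) := by
  refine tuple_ext fun i => ?_
  have h₀ := tuple_map_eqToHom (congrArg (fun F => F.obj Γ)
    (Ctx.map_comp (toFunctor F).obj (toFunctor G).obj).symm)
    ((toFunctor G).map (interpComparison F Γ) ≫ interpComparison G _) i i rfl
  refine Eq.trans ?_ h₀.symm
  refine Eq.trans ?_ (tuple_interpComparison G (Γ := (Ctx.map (toFunctor F).obj).obj Γ)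
    ((toFunctor G).map (interpComparison F Γ)) i).symm
  have h₂ := congrArg (toFunctor G).map (interpComparison_proj F Γ i)
  rw [Functor.map_comp] at h₂
  have h₁ := tuple_interpComparison (F ≫ G) (𝟙 _) i
  refine Eq.trans (congrArg (fun z => tuple z i) (Category.id_comp _).symm) (h₁.trans ?_)
  rw [Category.id_comp]
  exact congrArg (Sigma.mk _) h₂.symm

theorem prdMap_id : prdMap (𝟙 R) = 𝟙 (prdObj R) :=
  RgCalc.Hom.ext' <| CalcHomData.ext rfl <| heq_of_eq <| funext fun Γ =>
    OrderHom.ext _ _ <| funext fun (φ : Subobject (R.interp.obj Γ)) => by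
      exact (congrArg (fun z => imageSubobject (φ.arrow ≫ z)) (interpComparison_id Γ)).trans
        (eqHom_eq _ φ).symm

theorem prdMap_comp (F : R ⟶ R') (G : R' ⟶ R'') : prdMap (F ≫ G) = prdMap F ≫ prdMap G :=
  RgCalc.Hom.ext' <| CalcHomData.ext rfl <| heq_of_eq <| funext fun Γ =>
    OrderHom.ext _ _ <| funext fun (φ : Subobject (R.interp.obj Γ)) => by
      refine Eq.trans ?_ (eqHom_eq _ (imageSubobject ((toFunctor G).map
        (imageSubobject ((toFunctor F).map φ.arrow ≫ interpComparison F Γ)).arrow ≫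
          interpComparison G _))).symm
      refine Eq.trans ?_ (imageSubobject_arrow_image _ _).symm
      refine Eq.trans ?_ (congrArg (fun z => imageSubobject z) (Category.assoc _ _ _).symm)
      refine Eq.trans ?_ (imageSubobject_map_arrow (toFunctor G) (toFunctor_map_isRegularEpi G)
        ((toFunctor F).map φ.arrow ≫ interpComparison F Γ) _).symm
      refine congrArg (fun z => imageSubobject z) ?_
      rw [Functor.map_comp, Category.assoc]
      exact congrArg ((toFunctor G).map ((toFunctor F).map φ.arrow) ≫ ·)
        ((interpComparison_comp F G Γ).trans (Category.assoc _ _ _))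

/-- The functor from regular categories to regular calculi. -/
noncomputable def prd : RgCat.{v, u} ⥤ RgCalc.{max u v, u} where
  obj R := prdObj R
  map F := prdMap F
  map_id _ := prdMap_id
  map_comp := prdMap_comp

end RgCat

/-! ### Extending a transformation of subobjects to all morphisms -/

section Graph

variable {C : Type*} [Category* C] [CartesianMonoidalCategory C]
  {D : Type*} [Category* D] [Regular D] (J : C ⥤ D)

/-- The graph of a morphism `J Γ ⟶ J Δ` as a subobject of `J (Γ ⊗ Δ)`. -/
noncomputable def graphSubobject {Γ Δ : C} (f : J.obj Γ ⟶ J.obj Δ) : Subobject (J.obj (Γ ⊗ Δ)) :=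
  equalizerSubobject (J.map (fst Γ Δ) ≫ f) (J.map (snd Γ Δ))

variable {J}

theorem factors_graphSubobject_iff {Γ Δ : C} (f : J.obj Γ ⟶ J.obj Δ) {W : D}
    (z : W ⟶ J.obj (Γ ⊗ Δ)) :
    (graphSubobject J f).Factors z ↔ z ≫ J.map (fst Γ Δ) ≫ f = z ≫ J.map (snd Γ Δ) :=
  equalizerSubobject_factors_iff _ _ _

/-- The generic point `(1, f)` lies on the graph of `f`, hence on that of `g`. -/
theorem PreservesPairs.graphSubobject_injective (hJ : PreservesPairs J) {Γ Δ : C}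
    {f g : J.obj Γ ⟶ J.obj Δ} (h : graphSubobject J f = graphSubobject J g) : f = g := by
  obtain ⟨z, hz, hz'⟩ := hJ.exists_pair (𝟙 (J.obj Γ)) f
  have hf := (factors_graphSubobject_iff f z).2 (by rw [reassoc_of% hz, hz'])
  rw [h, factors_graphSubobject_iff, reassoc_of% hz, hz'] at hf
  exact hf.symm

/-- Expresses the graph by `⊤` and `∃` along a morphism of contexts, so that a logical family of
maps must preserve it. -/
theorem PreservesPairs.graphSubobject_map (hJ : PreservesPairs J) {Γ Δ : C} (f : Γ ⟶ Δ) :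
    graphSubobject J (J.map f) = (Subobject.exists (J.map (lift (𝟙 Γ) f))).obj ⊤ := by
  refine Subobject.ext_factors fun W z => ?_
  rw [factors_graphSubobject_iff, Subobject.factors_exists_iff]
  constructor
  · intro h
    refine Locally.of_id ⟨z ≫ J.map (fst Γ Δ), Subobject.top_factors _, hJ.pair_ext ?_ ?_⟩ <;>
      simp only [Category.assoc, ← J.map_comp, lift_fst, lift_snd, Category.id_comp,
        Category.comp_id]
    rwa [J.map_comp]
  · rintro ⟨W', e, he, y, -, hy⟩
    have : Epi e := inferInstance
    rw [← cancel_epi e, ← reassoc_of% hy, ← reassoc_of% hy]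
    simp only [← J.map_comp, lift_fst_assoc, lift_snd, Category.id_comp]

/-- In the internal language, `∃ x, f x = y ∧ φ x`: quantification along an arbitrary `f` reduces to
its graph and context projections. -/
theorem PreservesPairs.exists_eq (hJ : PreservesPairs J) {Γ Δ : C} (f : J.obj Γ ⟶ J.obj Δ)
    (φ : Subobject (J.obj Γ)) :
    (Subobject.exists f).obj φ = (Subobject.exists (J.map (snd Γ Δ))).obj
      (graphSubobject J f ⊓ (Subobject.pullback (J.map (fst Γ Δ))).obj φ) := by
  refine Subobject.ext_factors fun W z => ?_
  rw [Subobject.factors_exists_iff, Subobject.factors_exists_iff]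
  constructor <;> refine fun h => h.mono ?_
  · rintro W' e ⟨y, hy, hy'⟩
    obtain ⟨r, rfl, hr'⟩ := hJ.exists_pair y (e ≫ z)
    refine ⟨r, ?_, hr'⟩
    rw [Subobject.inf_factors, factors_graphSubobject_iff, Subobject.factors_pullback_iff]
    exact ⟨by rw [hr', ← hy', Category.assoc], hy⟩
  · rintro W' e ⟨y, hy, hy'⟩
    rw [Subobject.inf_factors, factors_graphSubobject_iff, Subobject.factors_pullback_iff] at hy
    exact ⟨y ≫ J.map (fst Γ Δ), hy.2, by rw [Category.assoc, hy.1, hy']⟩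

/-- In the internal language, `φ (f x)` is `∃ y, f x = y ∧ φ y`; the witness is unique, so no cover
is needed to produce it. -/
theorem PreservesPairs.pullback_eq (hJ : PreservesPairs J) {Γ Δ : C} (f : J.obj Γ ⟶ J.obj Δ)
    (φ : Subobject (J.obj Δ)) :
    (Subobject.pullback f).obj φ = (Subobject.exists (J.map (fst Γ Δ))).obj
      (graphSubobject J f ⊓ (Subobject.pullback (J.map (snd Γ Δ))).obj φ) := by
  refine Subobject.ext_factors fun W z => ?_
  rw [Subobject.factors_exists_iff, Subobject.factors_pullback_iff]
  constructor
  · intro h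
    obtain ⟨r, rfl, hr'⟩ := hJ.exists_pair z (z ≫ f)
    refine Locally.of_id ⟨r, ?_, by simp⟩
    rw [Subobject.inf_factors, factors_graphSubobject_iff, Subobject.factors_pullback_iff, hr']
    exact ⟨by simp, h⟩
  · rintro ⟨W', e, he, y, hy, hy'⟩
    rw [Subobject.inf_factors, factors_graphSubobject_iff, Subobject.factors_pullback_iff,
      reassoc_of% hy'] at hy
    rw [← Subobject.factors_cover_iff e, hy.1]
    exact hy.2

end Graph

/-- A family of maps `Sub (J Γ) → Sub (K Γ)` preserving the regular logic of contexts: finite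
meets, substitution and existential quantification along morphisms of contexts. -/
structure IsLogical {C : Type*} [Category* C] {D : Type*} [Category* D] [Regular D]
    {E : Type*} [Category* E] [Regular E] (J : C ⥤ D) (K : C ⥤ E)
    (a : ∀ {Γ : C}, Subobject (J.obj Γ) → Subobject (K.obj Γ)) : Prop where
  top {Γ : C} : a (⊤ : Subobject (J.obj Γ)) = ⊤
  inf {Γ : C} (φ ψ : Subobject (J.obj Γ)) : a (φ ⊓ ψ) = a φ ⊓ a ψ
  pullback {Γ Δ : C} (f : Γ ⟶ Δ) (φ : Subobject (J.obj Δ)) :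
    a ((Subobject.pullback (J.map f)).obj φ) = (Subobject.pullback (K.map f)).obj (a φ)
  exists' {Γ Δ : C} (f : Γ ⟶ Δ) (φ : Subobject (J.obj Γ)) :
    a ((Subobject.exists (J.map f)).obj φ) = (Subobject.exists (K.map f)).obj (a φ)

/-! ### Transport of functional relations -/

namespace IsLogical

variable {C : Type*} [Category* C] [CartesianMonoidalCategory C]
  {D : Type*} [Category* D] [Regular D] {E : Type*} [Category* E] [Regular E]
  {J : C ⥤ D} {K : C ⥤ E} {a : ∀ {Γ : C}, Subobject (J.obj Γ) → Subobject (K.obj Γ)}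

theorem mono (h : IsLogical J K a) {Γ : C} {φ ψ : Subobject (J.obj Γ)} (hφψ : φ ≤ ψ) :
    a φ ≤ a ψ := by
  rw [← inf_eq_left] at hφψ ⊢
  rw [← h.inf, hφψ]

theorem graphSubobject_map (h : IsLogical J K a) (hJ : PreservesPairs J) (hK : PreservesPairs K)
    {Γ Δ : C} (f : Γ ⟶ Δ) :
    a (graphSubobject J (J.map f)) = graphSubobject K (K.map f) := by
  rw [hJ.graphSubobject_map, hK.graphSubobject_map, h.exists', h.top]

theorem graphSubobject_id (h : IsLogical J K a) (hJ : PreservesPairs J) (hK : PreservesPairs K)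
    {Γ : C} : a (graphSubobject J (𝟙 (J.obj Γ))) = graphSubobject K (𝟙 (K.obj Γ)) := by
  rw [← J.map_id, ← K.map_id, h.graphSubobject_map hJ hK]

variable (h : IsLogical J K a) (hJ : PreservesPairs J) (hK : PreservesPairs K)
include h hJ hK

/-- Single-valuedness, `G(x, y) ∧ G(x, y') ≤ (y = y')`, is an inequality over `Γ ⊗ (Δ ⊗ Δ)` built
from substitution, meets and the graph of an identity. All of these are preserved by `a`. -/
theorem eq_of_factors_graphSubobject {Γ Δ : C} (f : J.obj Γ ⟶ J.obj Δ) {W : E}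
    {y z : W ⟶ K.obj (Γ ⊗ Δ)} (hy : (a (graphSubobject J f)).Factors y)
    (hz : (a (graphSubobject J f)).Factors z) (hyz : y ≫ K.map (fst Γ Δ) = z ≫ K.map (fst Γ Δ)) :
    y = z := by
  let p : Γ ⊗ (Δ ⊗ Δ) ⟶ Γ ⊗ Δ := lift (fst _ _) (snd _ _ ≫ fst _ _)
  let q : Γ ⊗ (Δ ⊗ Δ) ⟶ Γ ⊗ Δ := lift (fst _ _) (snd _ _ ≫ snd _ _)
  have hle : (Subobject.pullback (J.map p)).obj (graphSubobject J f) ⊓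
      (Subobject.pullback (J.map q)).obj (graphSubobject J f) ≤
        (Subobject.pullback (J.map (snd Γ (Δ ⊗ Δ)))).obj (graphSubobject J (𝟙 (J.obj Δ))) := by
    refine Subobject.le_iff_factors.2 fun W w => ?_
    simp only [Subobject.inf_factors, Subobject.factors_pullback_iff, factors_graphSubobject_iff,
      Category.assoc, ← J.map_comp, ← J.map_comp_assoc, p, q, lift_fst, lift_snd,
      Category.comp_id]
    rintro ⟨h₁, h₂⟩
    rw [← h₁, ← h₂]
  replace hle := h.mono hle
  rw [h.inf, h.pullback, h.pullback, h.pullback, h.graphSubobject_id hJ hK,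
    Subobject.le_iff_factors] at hle
  obtain ⟨r, hr, hr'⟩ := hK.exists_pair (y ≫ K.map (snd Γ Δ)) (z ≫ K.map (snd Γ Δ))
  obtain ⟨w, hw, hw'⟩ := hK.exists_pair (y ≫ K.map (fst Γ Δ)) r
  have hp : w ≫ K.map p = y := by
    apply hK.pair_ext <;> simp only [Category.assoc, ← K.map_comp, p, lift_fst, lift_snd]
    · exact hw
    · rw [K.map_comp, reassoc_of% hw', hr]
  have hq : w ≫ K.map q = z := by
    apply hK.pair_ext <;> simp only [Category.assoc, ← K.map_comp, q, lift_fst, lift_snd]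
    · exact hw.trans hyz
    · rw [K.map_comp, reassoc_of% hw', hr']
  have := hle _ w (by
    rw [Subobject.inf_factors, Subobject.factors_pullback_iff, Subobject.factors_pullback_iff,
      hp, hq]
    exact ⟨hy, hz⟩)
  rw [Subobject.factors_pullback_iff, factors_graphSubobject_iff, hw', Category.comp_id, hr,
    hr'] at this
  exact hK.pair_ext hyz this

/-- Totality transports to say that the first leg of `a G` is a regular epimorphism,
single-valuedness that it is a monomorphism. The leg is therefore invertible, and its inverse
followed by the second leg is the morphism sought. -/
theorem exists_extend {Γ Δ : C} (f : J.obj Γ ⟶ J.obj Δ) :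
    ∃ g : K.obj Γ ⟶ K.obj Δ, a (graphSubobject J f) = graphSubobject K g := by
  let G := a (graphSubobject J f)
  have htot : (Subobject.exists (J.map (fst Γ Δ))).obj (graphSubobject J f) = ⊤ := by
    refine Subobject.ext_factors fun W z => iff_of_true ?_ (Subobject.top_factors _)
    obtain ⟨r, hr, hr'⟩ := hJ.exists_pair z (z ≫ f)
    rw [Subobject.factors_exists_iff]
    refine Locally.of_id ⟨r, ?_, by simpa using hr⟩
    rw [factors_graphSubobject_iff, reassoc_of% hr, hr']
  replace htot := congrArg a htot
  rw [h.exists', h.top] at htot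
  have hepi : IsRegularEpi (G.arrow ≫ K.map (fst Γ Δ)) := by
    refine isRegularEpi_of_locally _ ?_
    have := (Subobject.factors_exists_iff (K.map (fst Γ Δ))).1
      (htot ▸ Subobject.top_factors (𝟙 (K.obj Γ)))
    refine this.mono ?_
    rintro W' e ⟨y, hy, hy'⟩
    obtain ⟨x, rfl⟩ := Subobject.factors_iff_exists.1 hy
    exact ⟨x, by rw [← Category.assoc, hy', Category.comp_id]⟩
  have hmono : Mono (G.arrow ≫ K.map (fst Γ Δ)) := by
    refine ⟨fun y z hyz => ?_⟩
    rw [← Category.assoc, ← Category.assoc] at hyz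
    rw [← cancel_mono G.arrow]
    exact h.eq_of_factors_graphSubobject hJ hK f (Subobject.factors_comp_arrow y)
      (Subobject.factors_comp_arrow z) hyz
  have : IsIso (G.arrow ≫ K.map (fst Γ Δ)) := isIso_of_mono_of_strongEpi _
  let g := inv (G.arrow ≫ K.map (fst Γ Δ)) ≫ G.arrow ≫ K.map (snd Γ Δ)
  have hg : G.arrow ≫ K.map (fst Γ Δ) ≫ g = G.arrow ≫ K.map (snd Γ Δ) := by
    rw [← Category.assoc, IsIso.hom_inv_id_assoc]
  refine ⟨g, Subobject.ext_factors fun W z => ?_⟩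
  rw [factors_graphSubobject_iff]
  constructor
  · intro hz
    obtain ⟨x, rfl⟩ := Subobject.factors_iff_exists.1 hz
    rw [Category.assoc, Category.assoc, hg]
  · intro hz
    let x := (z ≫ K.map (fst Γ Δ)) ≫ inv (G.arrow ≫ K.map (fst Γ Δ))
    refine Subobject.factors_iff_exists.2 ⟨x, hK.pair_ext ?_ ?_⟩
    · rw [Category.assoc]
      exact (Category.assoc _ _ _).trans (by rw [IsIso.inv_hom_id, Category.comp_id])
    · rw [← hz, Category.assoc]
      change ((z ≫ K.map (fst Γ Δ)) ≫ inv (G.arrow ≫ K.map (fst Γ Δ))) ≫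
        G.arrow ≫ K.map (snd Γ Δ) = _
      simp only [g, Category.assoc]

/-- The morphism `K Γ ⟶ K Δ` induced by a morphism `J Γ ⟶ J Δ`. -/
noncomputable def extend {Γ Δ : C} (f : J.obj Γ ⟶ J.obj Δ) : K.obj Γ ⟶ K.obj Δ :=
  (h.exists_extend hJ hK f).choose

theorem graphSubobject_extend {Γ Δ : C} (f : J.obj Γ ⟶ J.obj Δ) :
    a (graphSubobject J f) = graphSubobject K (h.extend hJ hK f) :=
  (h.exists_extend hJ hK f).choose_spec

theorem extend_map {Γ Δ : C} (f : Γ ⟶ Δ) : h.extend hJ hK (J.map f) = K.map f :=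
  hK.graphSubobject_injective
    ((h.graphSubobject_extend hJ hK _).symm.trans (h.graphSubobject_map hJ hK f))

theorem extend_id (Γ : C) : h.extend hJ hK (𝟙 (J.obj Γ)) = 𝟙 (K.obj Γ) := by
  rw [← J.map_id, extend_map, K.map_id]

/-- The inequality `G_f(x, y) ∧ G_g(y, z) ≤ G_{f ≫ g}(x, z)` is transported and evaluated at the
generic point `(1, f', f' ≫ g')`, where `f'` and `g'` are the extensions. -/
theorem extend_comp {Γ Δ Θ : C} (f : J.obj Γ ⟶ J.obj Δ) (g : J.obj Δ ⟶ J.obj Θ) :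
    h.extend hJ hK (f ≫ g) = h.extend hJ hK f ≫ h.extend hJ hK g := by
  let p : Γ ⊗ (Δ ⊗ Θ) ⟶ Γ ⊗ Δ := lift (fst _ _) (snd _ _ ≫ fst _ _)
  let q : Γ ⊗ (Δ ⊗ Θ) ⟶ Γ ⊗ Θ := lift (fst _ _) (snd _ _ ≫ snd _ _)
  have hle : (Subobject.pullback (J.map p)).obj (graphSubobject J f) ⊓
      (Subobject.pullback (J.map (snd Γ (Δ ⊗ Θ)))).obj (graphSubobject J g) ≤
        (Subobject.pullback (J.map q)).obj (graphSubobject J (f ≫ g)) := by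
    refine Subobject.le_iff_factors.2 fun W w => ?_
    simp only [Subobject.inf_factors, Subobject.factors_pullback_iff, factors_graphSubobject_iff,
      Category.assoc, ← J.map_comp, ← J.map_comp_assoc, p, q, lift_fst, lift_snd]
    rintro ⟨h₁, h₂⟩
    rw [← h₂, reassoc_of% h₁, J.map_comp_assoc]
  replace hle := h.mono hle
  rw [h.inf, h.pullback, h.pullback, h.pullback, h.graphSubobject_extend hJ hK,
    h.graphSubobject_extend hJ hK, h.graphSubobject_extend hJ hK, Subobject.le_iff_factors] at hle
  obtain ⟨r, hr, hr'⟩ := hK.exists_pair (h.extend hJ hK f)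
    (h.extend hJ hK f ≫ h.extend hJ hK g)
  obtain ⟨w, hw, hw'⟩ := hK.exists_pair (𝟙 (K.obj Γ)) r
  have := hle _ w
  simp only [Subobject.inf_factors, Subobject.factors_pullback_iff, factors_graphSubobject_iff,
      Category.assoc, ← K.map_comp, ← K.map_comp_assoc, p, q, lift_fst, lift_snd] at this
  simp only [K.map_comp, Category.assoc, reassoc_of% hw, reassoc_of% hw', hr, hr', reassoc_of% hr] at this
  exact this ⟨trivial, trivial⟩

theorem map_exists {Γ Δ : C} (f : J.obj Γ ⟶ J.obj Δ) (φ : Subobject (J.obj Γ)) :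
    a ((Subobject.exists f).obj φ) = (Subobject.exists (h.extend hJ hK f)).obj (a φ) := by
  rw [hJ.exists_eq, hK.exists_eq, h.exists', h.inf, h.pullback, h.graphSubobject_extend hJ hK]

theorem map_pullback {Γ Δ : C} (f : J.obj Γ ⟶ J.obj Δ) (φ : Subobject (J.obj Δ)) :
    a ((Subobject.pullback f).obj φ) = (Subobject.pullback (h.extend hJ hK f)).obj (a φ) := by
  rw [hJ.pullback_eq, hK.pullback_eq, h.exists', h.inf, h.pullback, h.graphSubobject_extend hJ hK]

theorem isRegularEpi_extend {Γ Δ : C} (f : J.obj Γ ⟶ J.obj Δ) (hf : IsRegularEpi f) :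
    IsRegularEpi (h.extend hJ hK f) := by
  rw [isRegularEpi_iff_exists_top] at hf ⊢
  rw [← h.top, ← h.map_exists, hf, h.top]

/-- The product `f × g` extends to the product of the extensions, because extension is functorial
and agrees with `K` on projections. -/
theorem exists_extend_pair {Γ Γ' Δ Δ' : C} (f : J.obj Γ ⟶ J.obj Δ) (g : J.obj Γ' ⟶ J.obj Δ') :
    ∃ c : J.obj (Γ ⊗ Γ') ⟶ J.obj (Δ ⊗ Δ'),
      (c ≫ J.map (fst Δ Δ') = J.map (fst Γ Γ') ≫ f ∧
        c ≫ J.map (snd Δ Δ') = J.map (snd Γ Γ') ≫ g) ∧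
      h.extend hJ hK c ≫ K.map (fst Δ Δ') = K.map (fst Γ Γ') ≫ h.extend hJ hK f ∧
        h.extend hJ hK c ≫ K.map (snd Δ Δ') = K.map (snd Γ Γ') ≫ h.extend hJ hK g := by
  obtain ⟨c, hc, hc'⟩ := hJ.exists_pair (J.map (fst Γ Γ') ≫ f) (J.map (snd Γ Γ') ≫ g)
  refine ⟨c, ⟨hc, hc'⟩, ?_, ?_⟩
  · rw [← h.extend_map hJ hK, ← h.extend_map hJ hK, ← h.extend_comp, ← h.extend_comp, hc]
  · rw [← h.extend_map hJ hK, ← h.extend_map hJ hK, ← h.extend_comp, ← h.extend_comp, hc']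

/-- Injectivity is the inequality `(f x = f x') ≤ (x = x')` over `Γ ⊗ Γ`. -/
theorem mono_extend {Γ Δ : C} (f : J.obj Γ ⟶ J.obj Δ) (hf : Mono f) :
    Mono (h.extend hJ hK f) := by
  obtain ⟨c, ⟨hc, hc'⟩, hd, hd'⟩ := h.exists_extend_pair hJ hK f f
  have hle : (Subobject.pullback c).obj (graphSubobject J (𝟙 (J.obj Δ))) ≤
      graphSubobject J (𝟙 (J.obj Γ)) := by
    refine Subobject.le_iff_factors.2 fun W w => ?_
    rw [Subobject.factors_pullback_iff, factors_graphSubobject_iff, factors_graphSubobject_iff,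
      Category.comp_id, Category.comp_id, Category.assoc, Category.assoc, hc, hc',
      ← Category.assoc, ← Category.assoc, cancel_mono]
    exact id
  replace hle := h.mono hle
  rw [h.map_pullback hJ hK, h.graphSubobject_id hJ hK, h.graphSubobject_id hJ hK,
    Subobject.le_iff_factors] at hle
  refine ⟨fun {W} y z hyz => ?_⟩
  obtain ⟨w, rfl, rfl⟩ := hK.exists_pair y z
  have := hle W w
  rw [Subobject.factors_pullback_iff, factors_graphSubobject_iff, factors_graphSubobject_iff,
    Category.comp_id, Category.comp_id, Category.assoc, Category.assoc, hd, hd'] at this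
  exact this (by simpa only [Category.assoc] using hyz)

/-- A square is a pullback when `m = (p, q)` is a monomorphism whose image in `X ⊗ Y` is `{(x, y) |
f x = g y}`. Both conditions survive the extension. -/
theorem isPullback_extend {P X Y Z : C} {p : J.obj P ⟶ J.obj X} {q : J.obj P ⟶ J.obj Y}
    {f : J.obj X ⟶ J.obj Z} {g : J.obj Y ⟶ J.obj Z} (sq : IsPullback p q f g) :
    IsPullback (h.extend hJ hK p) (h.extend hJ hK q) (h.extend hJ hK f) (h.extend hJ hK g) := by
  obtain ⟨m, hm, hm'⟩ := hJ.exists_pair p q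
  have hmono : Mono m := ⟨fun y z hyz => sq.hom_ext
    (by rw [← hm, reassoc_of% hyz]) (by rw [← hm', reassoc_of% hyz])⟩
  have hn : h.extend hJ hK m ≫ K.map (fst X Y) = h.extend hJ hK p := by
    rw [← h.extend_map hJ hK, ← h.extend_comp, hm]
  have hn' : h.extend hJ hK m ≫ K.map (snd X Y) = h.extend hJ hK q := by
    rw [← h.extend_map hJ hK, ← h.extend_comp, hm']
  have hmono' := h.mono_extend hJ hK m hmono
  obtain ⟨c, ⟨hc, hc'⟩, hd, hd'⟩ := h.exists_extend_pair hJ hK f g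
  have himg : (Subobject.exists m).obj ⊤ =
      (Subobject.pullback c).obj (graphSubobject J (𝟙 (J.obj Z))) := by
    refine Subobject.ext_factors fun W w => ?_
    rw [Subobject.factors_pullback_iff, factors_graphSubobject_iff, Category.comp_id,
      Category.assoc, Category.assoc, hc, hc', Subobject.factors_exists_iff]
    constructor
    · rintro ⟨W', e, he, y, -, hy⟩
      have : Epi e := inferInstance
      rw [← cancel_epi e, ← reassoc_of% hy, ← reassoc_of% hy, reassoc_of% hm, reassoc_of% hm', sq.w]
    · intro hw
      refine Locally.of_id ⟨sq.lift (w ≫ J.map (fst X Y)) (w ≫ J.map (snd X Y))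
        (by simpa only [Category.assoc] using hw), Subobject.top_factors _, hJ.pair_ext ?_ ?_⟩
      · rw [Category.assoc, hm, sq.lift_fst, Category.id_comp]
      · rw [Category.assoc, hm', sq.lift_snd, Category.id_comp]
  replace himg := congrArg a himg
  rw [h.map_exists hJ hK, h.map_pullback hJ hK, h.top, h.graphSubobject_id hJ hK] at himg
  have key : ∀ {W : E} (y : W ⟶ K.obj X) (z : W ⟶ K.obj Y),
      y ≫ h.extend hJ hK f = z ≫ h.extend hJ hK g →
        ∃ w, w ≫ h.extend hJ hK p = y ∧ w ≫ h.extend hJ hK q = z := by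
    intro W y z hyz
    obtain ⟨w, rfl, rfl⟩ := hK.exists_pair y z
    have hw : ((Subobject.pullback (h.extend hJ hK c)).obj
        (graphSubobject K (𝟙 (K.obj Z)))).Factors w := by
      rw [Subobject.factors_pullback_iff, factors_graphSubobject_iff, Category.comp_id,
        Category.assoc, Category.assoc, hd, hd']
      simpa only [Category.assoc] using hyz
    rw [← himg, Subobject.factors_exists_iff] at hw
    obtain ⟨W', e, he, x, -, hx⟩ := hw
    -- The extension of `m` is a monomorphism, so the local preimage descends to a global one.
    obtain ⟨r, rfl⟩ := exists_lift_of_cover (h.extend hJ hK m) e ⟨x, hx⟩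
    exact ⟨r, by rw [Category.assoc, hn], by rw [Category.assoc, hn']⟩
  refine ⟨⟨by rw [← h.extend_comp, ← h.extend_comp, sq.w]⟩,
    ⟨PullbackCone.IsLimit.mk _ (fun s => (key s.fst s.snd s.condition).choose)
      (fun s => (key s.fst s.snd s.condition).choose_spec.1)
      (fun s => (key s.fst s.snd s.condition).choose_spec.2) fun s r hr hr' => ?_⟩⟩
  obtain ⟨h₁, h₂⟩ := (key s.fst s.snd s.condition).choose_spec
  rw [← cancel_mono (h.extend hJ hK m)]
  apply hK.pair_ext <;> simp only [Category.assoc, hn, hn']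
  · exact hr.trans h₁.symm
  · exact hr'.trans h₂.symm

section Functor

variable (s : D → C) (ι : ∀ X, J.obj (s X) ≅ X)

/-- The functor `D ⥤ E` extending `K` along `J`, when every object of `D` is of the form `J Γ`. -/
noncomputable def functor : D ⥤ E where
  obj X := K.obj (s X)
  map {X Y} f := h.extend hJ hK ((ι X).hom ≫ f ≫ (ι Y).inv)
  map_id X := by simp [h.extend_id]
  map_comp f g := by simp [← h.extend_comp]

theorem functor_map_isRegularEpi {X Y : D} (f : X ⟶ Y) (hf : IsRegularEpi f) :
    IsRegularEpi ((h.functor hJ hK s ι).map f) := by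
  refine h.isRegularEpi_extend hJ hK _ ?_
  refine isRegularEpi_comp _ _ inferInstance (isRegularEpi_comp _ _ hf inferInstance)

theorem functor_preservesFiniteLimits : PreservesFiniteLimits (h.functor hJ hK s ι) := by
  have hpb : PreservesLimitsOfShape WalkingCospan (h.functor hJ hK s ι) := by
    refine ⟨fun {G} => ?_⟩
    suffices ∀ {X Y Z : D} (f : X ⟶ Z) (g : Y ⟶ Z),
        PreservesLimit (cospan f g) (h.functor hJ hK s ι) from
      preservesLimit_of_iso_diagram _ (diagramIsoCospan G).symm
    intro X Y Z f g
    refine preservesLimit_of_preserves_limit_cone (pullbackIsPullback f g) ?_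
    apply (isLimitMapConePullbackConeEquiv _ _).symm _
    -- The pullback square in `D` is conjugated by `ι` into one between objects of the form `J Γ`,
    -- where extension applies.
    have sq : IsPullback ((ι _).hom ≫ pullback.fst f g ≫ (ι _).inv)
        ((ι _).hom ≫ pullback.snd f g ≫ (ι _).inv) ((ι X).hom ≫ f ≫ (ι Z).inv)
        ((ι Y).hom ≫ g ≫ (ι Z).inv) := by
      refine IsPullback.of_iso (IsPullback.of_hasPullback f g) (ι _).symm (ι _).symm (ι _).symm
        (ι _).symm ?_ ?_ ?_ ?_ <;> simp
    exact (h.isPullback_extend hJ hK sq).isLimit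
  have hterm : PreservesLimitsOfShape (Discrete.{0} PEmpty) (h.functor hJ hK s ι) := by
    have hU : IsTerminal (J.obj (𝟙_ C)) :=
      IsTerminal.ofUniqueHom (fun W => (hJ.exists_unit W).some) fun _ _ => hJ.unit_ext _ _
    have hV : IsTerminal (K.obj (𝟙_ C)) :=
      IsTerminal.ofUniqueHom (fun W => (hK.exists_unit W).some) fun _ _ => hK.unit_ext _ _
    -- The context chosen for the terminal object need not be the unit, but their interpretations
    -- under `J` are isomorphic, and extension preserves isomorphisms.
    let i : J.obj (s (⊤_ D)) ≅ J.obj (𝟙_ C) := ι _ ≪≫ terminalIsTerminal.uniqueUpToIso hU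
    let j : K.obj (s (⊤_ D)) ≅ K.obj (𝟙_ C) :=
      ⟨h.extend hJ hK i.hom, h.extend hJ hK i.inv,
        by rw [← h.extend_comp, i.hom_inv_id, h.extend_id],
        by rw [← h.extend_comp, i.inv_hom_id, h.extend_id]⟩
    have := preservesTerminal_of_iso (h.functor hJ hK s ι)
      (j ≪≫ hV.uniqueUpToIso terminalIsTerminal)
    exact preservesLimitsOfShape_pempty_of_preservesTerminal _
  exact preservesFiniteLimits_of_preservesTerminal_and_pullbacks _

end Functor

end IsLogical

/-! ### Monoidal transformations preserve regular logic -/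

namespace SubLax

variable {D : Type u} [Category.{v} D] [CartesianMonoidalCategory D] [Regular D]
  {D' : Type u} [Category.{v} D'] [CartesianMonoidalCategory D'] [Regular D']
  {C : Type*} [Category* C] [CartesianMonoidalCategory C] [Regular C]
  {C' : Type*} [Category* C'] [CartesianMonoidalCategory C'] [Regular C']
  {J : C ⥤ D} {J' : C' ⥤ D'} {H : C ⥤ C'}
  {a : ∀ X, (subLax J).obj X →o (subLax J').obj (H.obj X)}

/-- A family of maps between the values of `subLax`, as a map of subobjects. -/
noncomputable def subobjectMap (a : ∀ X, (subLax J).obj X →o (subLax J').obj (H.obj X)) {X : C}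
    (φ : Subobject (J.obj X)) : Subobject ((H ⋙ J').obj X) :=
  a X φ

variable (ha : (subLax J).IsMonoidalNat H (subLax J') a) (hJ : PreservesRel J)
  (hJ' : PreservesRel J') (hHJ' : PreservesPairs (H ⋙ J'))
  (hH : ∀ {X Y : C} (f : X ⟶ Y), IsRegularEpi f → IsRegularEpi (H.map f))

include ha hJ hJ' hH in
theorem subobjectMap_exists {X Y : C} (f : X ⟶ Y) (φ : Subobject (J.obj X)) :
    subobjectMap a ((Subobject.exists (J.map f)).obj φ) =
      (Subobject.exists ((H ⋙ J').map f)).obj (subobjectMap a φ) := by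
  have h₁ : subobjectMap a (act J (RelHom.graph f) φ) =
      act J' (RelHom.map H (RelHom.graph f)) (subobjectMap a φ) := ha.natural _ _
  rw [act_graph hJ.map_isRegularEpi, RelHom.map_graph H hH] at h₁
  exact h₁.trans (act_graph hJ'.map_isRegularEpi _ _)

include ha hJ hJ' hH in
theorem subobjectMap_pullback {X Y : C} (f : X ⟶ Y) (φ : Subobject (J.obj Y)) :
    subobjectMap a ((Subobject.pullback (J.map f)).obj φ) =
      (Subobject.pullback ((H ⋙ J').map f)).obj (subobjectMap a φ) := by
  have h₁ : subobjectMap a (act J (RelHom.ofSpan f (𝟙 X)) φ) =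
      act J' (RelHom.map H (RelHom.ofSpan f (𝟙 X))) (subobjectMap a φ) := ha.natural _ _
  rw [act_ofSpan_id hJ.map_isRegularEpi, RelHom.map_ofSpan H hH, H.map_id] at h₁
  exact h₁.trans (act_ofSpan_id hJ'.map_isRegularEpi _ _)

include ha hJ hJ' hHJ' hH in
-- The unit law gives the case of the unit context; every other `⊤` is a substitution instance of
-- that one.
theorem subobjectMap_top {X : C} : subobjectMap a (⊤ : Subobject (J.obj X)) = ⊤ := by
  have hu : (Subobject.exists (J'.map (CartesianMonoidalCategory.terminalComparison H))).obj
      (subobjectMap a (⊤ : Subobject (J.obj (𝟙_ C)))) = ⊤ :=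
    (act_graph hJ'.map_isRegularEpi _ _).symm.trans ha.unit
  have ht : subobjectMap a (⊤ : Subobject (J.obj (𝟙_ C))) = ⊤ := by
    refine Subobject.ext_factors fun W z => iff_of_true ?_ (Subobject.top_factors _)
    have := hu ▸ Subobject.top_factors
      (z ≫ J'.map (CartesianMonoidalCategory.terminalComparison H))
    obtain ⟨W', e, he, y, hy, -⟩ := (Subobject.factors_exists_iff _).1 this
    -- Elements of `J' (H 1)` at a given stage coincide, so the terminal comparison can be removed.
    rw [← Subobject.factors_cover_iff e, hHJ'.unit_ext (e ≫ z) y]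
    exact hy
  have h₁ : (⊤ : Subobject (J.obj X)) = (Subobject.pullback (J.map (toUnit X))).obj ⊤ :=
    Subobject.pullback_top _ |>.symm
  rw [h₁, subobjectMap_pullback ha hJ hJ' hH, ht, Subobject.pullback_top]

include ha hJ' hHJ' in
-- The laxator law holds only after the image along the product comparison `c`. As `c` is injective
-- on elements, this image can be undone.
theorem factors_subobjectMap_prod_iff {X Y : C} (φ : Subobject (J.obj X))
    (ψ : Subobject (J.obj Y)) {W : D'} (z : W ⟶ (H ⋙ J').obj (X ⊗ Y)) :
    (subobjectMap a (prod J φ ψ)).Factors z ↔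
      (subobjectMap a φ).Factors (z ≫ (H ⋙ J').map (fst X Y)) ∧
        (subobjectMap a ψ).Factors (z ≫ (H ⋙ J').map (snd X Y)) := by
  let c : (H ⋙ J').obj (X ⊗ Y) ⟶ J'.obj (H.obj X ⊗ H.obj Y) :=
    J'.map (CartesianMonoidalCategory.prodComparison H X Y)
  have hl : (Subobject.exists c).obj (subobjectMap a (prod J φ ψ)) =
      prod J' (subobjectMap a φ) (subobjectMap a ψ) :=
    (act_graph hJ'.map_isRegularEpi _ _).symm.trans (ha.lax φ ψ)
  have h₁ : c ≫ J'.map (fst _ _) = (H ⋙ J').map (fst X Y) :=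
    (J'.map_comp _ _).symm.trans
      (congrArg J'.map (CartesianMonoidalCategory.prodComparison_fst H X Y))
  have h₂ : c ≫ J'.map (snd _ _) = (H ⋙ J').map (snd X Y) :=
    (J'.map_comp _ _).symm.trans
      (congrArg J'.map (CartesianMonoidalCategory.prodComparison_snd H X Y))
  have key : (prod J' (subobjectMap a φ) (subobjectMap a ψ)).Factors (z ≫ c) ↔
      (subobjectMap a φ).Factors (z ≫ (H ⋙ J').map (fst X Y)) ∧
        (subobjectMap a ψ).Factors (z ≫ (H ⋙ J').map (snd X Y)) := by
    rw [← h₁, ← h₂, ← Category.assoc, ← Category.assoc]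
    exact factors_prod_iff _ _ _
  rw [← key, ← hl, Subobject.factors_exists_iff]
  constructor
  · exact fun hz => Locally.of_id ⟨z, hz, (Category.id_comp _).symm⟩
  · rintro ⟨W', e, he, y, hy, hy'⟩
    have : y = e ≫ z := by
      apply hHJ'.pair_ext
      · rw [← h₁, reassoc_of% hy', Category.assoc]
      · rw [← h₂, reassoc_of% hy', Category.assoc]
    rw [← Subobject.factors_cover_iff e, ← this]
    exact hy

include ha hJ hJ' hHJ' hH in
/-- A monoidal natural transformation of subobject po-functors preserves the regular logic. -/
theorem isLogical : IsLogical J (H ⋙ J') (subobjectMap a) where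
  top := subobjectMap_top ha hJ hJ' hHJ' hH
  pullback := subobjectMap_pullback ha hJ hJ' hH
  exists' := subobjectMap_exists ha hJ hJ' hH
  inf {X} φ ψ := by
    -- A meet is the restriction of an external product to the diagonal, which reduces it to the
    -- laxator and substitution.
    have h₁ : φ ⊓ ψ = (Subobject.pullback (J.map (lift (𝟙 X) (𝟙 X)))).obj (prod J φ ψ) := by
      refine Subobject.ext_factors fun W z => ?_
      rw [Subobject.inf_factors, Subobject.factors_pullback_iff, factors_prod_iff]
      simp only [Category.assoc, ← J.map_comp, lift_fst, lift_snd, J.map_id, Category.comp_id]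
    refine Subobject.ext_factors fun W z => ?_
    rw [h₁, subobjectMap_pullback ha hJ hJ' hH, Subobject.factors_pullback_iff,
      factors_subobjectMap_prod_iff ha hJ' hHJ', Subobject.inf_factors]
    simp only [Category.assoc, ← (H ⋙ J').map_comp, lift_fst, lift_snd, (H ⋙ J').map_id,
      Category.comp_id]

end SubLax

theorem isRegularEpi_hom {C : Type*} [Category* C] {X Y : C} (i : X ≅ Y) : IsRegularEpi i.hom :=
  inferInstance

theorem exists_top_eq {C : Type*} [Category* C] [Regular C] {X Y : C} (f : X ⟶ Y) :
    (Subobject.exists f).obj ⊤ = imageSubobject f := by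
  rw [Subobject.exists_eq_imageSubobject]
  exact imageSubobject_precomp _ inferInstance f

/-! ### Recovering a regular functor from a morphism of calculi -/

namespace RgCat

variable {R R' : RgCat.{v, u}}

/-- The context with a single variable. -/
def single (X : R) : Ctx R where
  n := 1
  S := {X}
  finite_S := Set.finite_singleton X
  τ _ := X
  τ_mem _ := rfl

/-- The morphism selecting a variable of a context. -/
def toSingle (Γ : Ctx R) (i : Fin Γ.n) : Γ ⟶ single (Γ.τ i) :=
  ⟨fun _ => i, Set.singleton_subset_iff.2 (Γ.τ_mem i), fun _ => rfl⟩

/-- With one variable and no further types in the support, the support factor is redundant: `X`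
always maps to `Supp(X)`. -/
theorem isIso_proj {Γ : Ctx R} (i : Fin Γ.n) (hn : ∀ j, j = i) (hS : ∀ s ∈ Γ.S, s = Γ.τ i) :
    IsIso (proj Γ i) := by
  obtain ⟨z, hz⟩ := exists_tuple (Γ := Γ) (W := Γ.τ i) (fun _ => ⟨Γ.τ i, 𝟙 _⟩)
    (fun j => by rw [hn j]) (fun s hs => hS s hs ▸ ⟨toSupp s⟩)
  have hz' : z ≫ proj Γ i = 𝟙 _ := eq_of_heq (Sigma.mk.inj (hz i)).2
  refine ⟨z, interp_hom_ext fun j => ?_, hz'⟩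
  rw [hn j, Category.assoc, hz', Category.comp_id, Category.id_comp]

/-- The interpretation of a context with a single variable of type `t X`. -/
noncomputable def singleIso {T : RgCat.{v, u}} (t : T → R) (X : T) :
    R.interp.obj ((Ctx.map t).obj (single X)) ≅ t X :=
  @asIso _ _ _ _ (proj ((Ctx.map t).obj (single X)) (0 : Fin 1))
    (isIso_proj (Γ := (Ctx.map t).obj (single X)) (0 : Fin 1)
      (fun j => Subsingleton.elim (α := Fin 1) j 0)
      (by rintro _ ⟨s, hs, rfl⟩; exact congrArg t hs))

/-- The interpretation of a context with a single variable. -/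
noncomputable def interpSingleIso (X : R) : R.interp.obj (single X) ≅ X :=
  @asIso _ _ _ _ (proj (single X) (0 : Fin 1))
    (isIso_proj (Γ := single X) (0 : Fin 1) (fun j => Subsingleton.elim (α := Fin 1) j 0)
      fun _ hs => hs)

theorem interp_map_toSingle (Γ : Ctx R) (i : Fin Γ.n) :
    R.interp.map (toSingle Γ i) ≫ (interpSingleIso (Γ.τ i)).hom = proj Γ i :=
  (interp_map_proj (toSingle Γ i) (0 : Fin 1)).trans (Category.comp_id _)

theorem interp_map_map_toSingle {T : RgCat.{v, u}} (t : T → R) (Γ : Ctx T) (i : Fin Γ.n) :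
    R.interp.map ((Ctx.map t).map (toSingle Γ i)) ≫ (singleIso t (Γ.τ i)).hom =
      proj ((Ctx.map t).obj Γ) i :=
  (interp_map_proj ((Ctx.map t).map (toSingle Γ i)) (0 : Fin 1)).trans (Category.comp_id _)

section OfHom

variable (H : RgCalc.Hom (prdObj R) (prdObj R'))

/-- The action of a morphism of calculi on objects. -/
def homFun : R → R' :=
  H.toFun

/-- The action of a morphism of calculi on subobjects. -/
noncomputable def homApp {Γ : Ctx R} (φ : Subobject (R.interp.obj Γ)) :
    Subobject ((Ctx.map (homFun H) ⋙ R'.interp).obj Γ) :=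
  H.app Γ φ

theorem isLogical_homApp :
    IsLogical R.interp (Ctx.map (homFun H) ⋙ R'.interp) (homApp H) :=
  SubLax.isLogical (J := R.interp) (J' := R'.interp) (H := Ctx.map (homFun H))
    H.isMonoidalNat (preservesRel_interp R) (preservesRel_interp R') (preservesPairs_map_interp _)
    (Ctx.isRegularEpi_map _)

/-- The morphism `⌜F Γ⌝ ⟶ ⌜F Δ⌝` induced by a morphism `⌜Γ⌝ ⟶ ⌜Δ⌝` of `R`. -/
noncomputable def homExtend {Γ Δ : Ctx R} (f : R.interp.obj Γ ⟶ R.interp.obj Δ) :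
    (Ctx.map (homFun H) ⋙ R'.interp).obj Γ ⟶
      (Ctx.map (homFun H) ⋙ R'.interp).obj Δ :=
  (isLogical_homApp H).extend (preservesPairs_interp R) (preservesPairs_map_interp _) f

/-- The functor underlying a morphism of calculi, up to isomorphism. -/
noncomputable def singleFunctor : R ⥤ R' :=
  (isLogical_homApp H).functor (preservesPairs_interp R) (preservesPairs_map_interp _) single
    interpSingleIso

/-- The functor underlying a morphism of calculi. -/
noncomputable def functorOfHom : R ⥤ R' :=
  -- The values on objects are replaced by isomorphic ones so that the action on objects is exactly
  -- `homFun H`; equality of morphisms of calculi demands this strictness.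
  (singleFunctor H).copyObj (homFun H) fun X => singleIso (homFun H) X

theorem functorOfHom_map {X Y : R} (f : X ⟶ Y) :
    (functorOfHom H).map f = (singleIso (homFun H) X).inv ≫
      homExtend H ((interpSingleIso X).hom ≫ f ≫ (interpSingleIso Y).inv) ≫
        (singleIso (homFun H) Y).hom :=
  rfl

/-- The regular functor underlying a morphism of calculi. -/
noncomputable def ofHom : R ⟶ R' where
  functor := functorOfHom H
  preservesFiniteLimits :=
    have : PreservesFiniteLimits (singleFunctor H) :=
      (isLogical_homApp H).functor_preservesFiniteLimits _ _ _ _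
    preservesFiniteLimits_of_natIso ((singleFunctor H).isoCopyObj _ _)
  map_isRegularEpi f hf := by
    rw [functorOfHom_map]
    exact isRegularEpi_comp _ _ (isRegularEpi_hom (singleIso (homFun H) _).symm)
      (isRegularEpi_comp _ _
      ((isLogical_homApp H).functor_map_isRegularEpi (preservesPairs_interp R)
        (preservesPairs_map_interp _) single interpSingleIso f hf)
        (isRegularEpi_hom (singleIso (homFun H) _)))

/-- Both sides are compared at each variable of `Γ`. The projection to a variable comes from a
morphism of contexts, where extension is known, and the rest is functoriality of extension and the
definition of `ofHom H`. -/
theorem homExtend_arrow {Γ : Ctx R} {A : R} (m : A ⟶ R.interp.obj Γ) :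
    homExtend H ((interpSingleIso A).hom ≫ m) =
      (singleIso (homFun H) A).hom ≫
        (toFunctor (ofHom H)).map m ≫ interpComparison (ofHom H) Γ := by
  refine interp_hom_ext (Γ := (Ctx.map (homFun H)).obj Γ) fun (i : Fin Γ.n) => ?_
  have h₁ : proj ((Ctx.map (homFun H)).obj Γ) i =
      homExtend H (R.interp.map (toSingle Γ i)) ≫ (singleIso (homFun H) (Γ.τ i)).hom := by
    rw [homExtend, (isLogical_homApp H).extend_map]
    exact (interp_map_map_toSingle (homFun H) Γ i).symm
  have h₂ : (toFunctor (ofHom H)).map m ≫ (toFunctor (ofHom H)).map (proj Γ i) =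
      (singleIso (homFun H) A).inv ≫
        homExtend H ((interpSingleIso A).hom ≫ m ≫ R.interp.map (toSingle Γ i)) ≫
          (singleIso (homFun H) (Γ.τ i)).hom := by
    have : R.interp.map (toSingle Γ i) = proj Γ i ≫ (interpSingleIso (Γ.τ i)).inv := by
      rw [Iso.eq_comp_inv, interp_map_toSingle]
    rw [← Functor.map_comp, this, ← Category.assoc m]
    exact functorOfHom_map H (m ≫ proj Γ i)
  have h₃ : homExtend H ((interpSingleIso A).hom ≫ m ≫ R.interp.map (toSingle Γ i)) =
      homExtend H ((interpSingleIso A).hom ≫ m) ≫ homExtend H (R.interp.map (toSingle Γ i)) :=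
    (congrArg (homExtend H) (Category.assoc _ _ _).symm).trans
      ((isLogical_homApp H).extend_comp _ _ _ _)
  have h₄ := interpComparison_proj (ofHom H) Γ i
  refine Eq.trans ?_ (Category.assoc _ _ _).symm
  refine Eq.trans ?_ (congrArg ((singleIso (homFun H) A).hom ≫ ·) (Category.assoc _ _ _).symm)
  refine Eq.trans ?_ (congrArg (fun k => (singleIso (homFun H) A).hom ≫
    (toFunctor (ofHom H)).map m ≫ k) h₄.symm)
  refine Eq.trans ?_ (congrArg ((singleIso (homFun H) A).hom ≫ ·) h₂.symm)
  refine Eq.trans ?_ (Iso.hom_inv_id_assoc (singleIso (homFun H) A) _).symm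
  refine Eq.trans ?_ (congrArg (· ≫ (singleIso (homFun H) (Γ.τ i)).hom) h₃.symm)
  exact (congrArg (homExtend H ((interpSingleIso A).hom ≫ m) ≫ ·) h₁).trans
    (Category.assoc _ _ _).symm

/-- Every `φ` is `∃ ⊤` along its inclusion, precomposed with `⌜single φ⌝ ≅ φ`. Hence `H` sends `φ`
to the image of the extension of that morphism, which `homExtend_arrow` identifies with the image
under `ofHom H`. -/
theorem prdMap_ofHom : prdMap (ofHom H) = H := by
  refine RgCalc.Hom.ext' <| CalcHomData.ext rfl <| heq_of_eq <| funext fun Γ =>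
    OrderHom.ext _ _ <| funext fun (φ : Subobject (R.interp.obj Γ)) => ?_
  have h₁ : φ = (Subobject.exists ((interpSingleIso (φ : R)).hom ≫ φ.arrow)).obj ⊤ := by
    rw [exists_top_eq, imageSubobject_precomp _ inferInstance, imageSubobject_mono,
      Subobject.mk_arrow]
  have h₂ : homApp H φ = imageSubobject (homExtend H ((interpSingleIso (φ : R)).hom ≫ φ.arrow)) := by
    refine (congrArg (homApp H) h₁).trans (Eq.trans ((isLogical_homApp H).map_exists
      (preservesPairs_interp R) (preservesPairs_map_interp _) _ _) ?_)
    rw [(isLogical_homApp H).top, exists_top_eq]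
    rfl
  refine Eq.trans ?_ h₂.symm
  refine Eq.trans ?_ (congrArg (fun z => imageSubobject z) (homExtend_arrow H φ.arrow)).symm
  exact (imageSubobject_precomp _ (isRegularEpi_hom (singleIso (homFun H) (φ : R))) _).symm

end OfHom

/-- The generic point `(1, f)` lies on the graph of `f`. Its image under `F`, carried along the
comparison, therefore lies on the graph of the extension; reading off the two components gives the
equation. -/
theorem homExtend_prdMap (F : R ⟶ R') {Γ Δ : Ctx R} (f : R.interp.obj Γ ⟶ R.interp.obj Δ) :
    interpComparison F Γ ≫ homExtend (prdMap F) f =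
      (toFunctor F).map f ≫ interpComparison F Δ := by
  have hK := preservesPairs_map_interp (toFunctor F).obj
  obtain ⟨m, hm, hm'⟩ := (preservesPairs_interp R).exists_pair (𝟙 (R.interp.obj Γ)) f
  have nat : ∀ {Γ Δ : Ctx R} (f : Γ ⟶ Δ),
      (toFunctor F).map (R.interp.map f) ≫ interpComparison F Δ =
        interpComparison F Γ ≫ R'.interp.map ((Ctx.map (toFunctor F).obj).map f) :=
    fun f => (interpIso F).hom.naturality f
  have hmem : (graphSubobject R.interp f).Factors m := by
    rw [factors_graphSubobject_iff, reassoc_of% hm, hm']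
  have h₁ : (homApp (prdMap F) (graphSubobject R.interp f)).Factors
      ((toFunctor F).map m ≫ interpComparison F (Γ ⊗ Δ)) := by
    obtain ⟨y, hy⟩ := Subobject.factors_iff_exists.1 hmem
    have h := imageSubobject_factors_comp_self
      ((toFunctor F).map (graphSubobject R.interp f).arrow ≫ interpComparison F (Γ ⊗ Δ))
      ((toFunctor F).map y)
    rw [← Category.assoc, ← Functor.map_comp, hy] at h
    exact h
  rw [(isLogical_homApp (prdMap F)).graphSubobject_extend (preservesPairs_interp R) hK] at h₁
  have h₂ := (factors_graphSubobject_iff _ _).1 h₁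
  have h₃ : ((toFunctor F).map m ≫ interpComparison F (Γ ⊗ Δ)) ≫
      R'.interp.map ((Ctx.map (toFunctor F).obj).map (fst Γ Δ)) = interpComparison F Γ := by
    rw [Category.assoc, ← nat, ← Category.assoc, ← Functor.map_comp, hm, CategoryTheory.Functor.map_id,
      Category.id_comp]
  have h₄ : ((toFunctor F).map m ≫ interpComparison F (Γ ⊗ Δ)) ≫
      R'.interp.map ((Ctx.map (toFunctor F).obj).map (snd Γ Δ)) =
        (toFunctor F).map f ≫ interpComparison F Δ := by
    rw [Category.assoc, ← nat, ← Category.assoc, ← Functor.map_comp, hm']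
  exact (congrArg (· ≫ homExtend (prdMap F) f) h₃.symm).trans
    ((Category.assoc _ _ _).trans (h₂.trans h₄))

theorem ofHom_prdMap (F : R ⟶ R') : toFunctor (ofHom (prdMap F)) = toFunctor F := by
  -- The objects agree by definition; on morphisms, `homExtend_prdMap` is applied between
  -- one-variable contexts and the comparison isomorphisms cancel.
  refine CategoryTheory.Functor.ext (fun _ => rfl) fun X Y f => ?_
  have hκ : ∀ X : R, interpComparison F (single X) ≫ (singleIso (toFunctor F).obj X).hom =
      (toFunctor F).map (interpSingleIso X).hom :=
    fun X => interpComparison_proj F (single X) (0 : Fin 1)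
  have h := homExtend_prdMap F ((interpSingleIso X).hom ≫ f ≫ (interpSingleIso Y).inv)
  refine Eq.trans (b := (toFunctor F).map f) ?_
    ((Category.comp_id _).symm.trans (Category.id_comp _).symm)
  refine (functorOfHom_map (prdMap F) f).trans ?_
  refine (Iso.inv_comp_eq (singleIso (toFunctor F).obj X)).2 ?_
  refine (cancel_epi (interpComparison F (single X))).1 ?_
  refine Eq.trans ?_ ((congrArg (· ≫ (toFunctor F).map f) (hκ X).symm).trans (Category.assoc _ _ _))
  refine (Category.assoc _ _ _).symm.trans ((congrArg (· ≫ _) h).trans ?_)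
  refine (Category.assoc _ _ _).trans ((congrArg (_ ≫ ·) (hκ Y)).trans ?_)
  rw [← Functor.map_comp, ← Functor.map_comp]
  simp

end RgCat

/-- `ofHom` is a left inverse of `prd` on morphisms, which gives faithfulness; that it is also a
right inverse gives fullness. -/
theorem prd_faithful : RgCat.prd.{v, u}.Faithful where
  map_injective {R R' F G} h := by
    have h' : RgCat.toFunctor F = RgCat.toFunctor G := by
      rw [← RgCat.ofHom_prdMap F, ← RgCat.ofHom_prdMap G]
      exact congrArg (fun H => RgCat.toFunctor (RgCat.ofHom H)) h
    obtain ⟨F, _, _⟩ := F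
    obtain ⟨G, _, _⟩ := G
    obtain rfl : F = G := h'
    rfl

theorem prd_full : RgCat.prd.{v, u}.Full where
  map_surjective H := ⟨RgCat.ofHom H, RgCat.prdMap_ofHom H⟩

end GraphicalRegularLogic

theorem proposition4p15 :
    ∃ prd : GraphicalRegularLogic.RgCat.{v, u} ⥤ GraphicalRegularLogic.RgCalc.{max u v, u},
      (∀ R : GraphicalRegularLogic.RgCat.{v, u}, (prd.obj R).toCalcData = R.prdData) ∧
      (∀ {R R' : GraphicalRegularLogic.RgCat.{v, u}} (F : R ⟶ R'),
        HEq (prd.map F).toCalcHomData (GraphicalRegularLogic.RgCat.prdMapData F)) ∧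
      prd.Faithful ∧ prd.Full :=
  ⟨GraphicalRegularLogic.RgCat.prd, fun _ => rfl, fun _ => HEq.rfl,
    GraphicalRegularLogic.prd_faithful, GraphicalRegularLogic.prd_full⟩
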